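/- Let $so(7)$ be the complex Lie algebra of the symmetric bilinear form $B$ on the space with basis $e_1,e_2,e_3,e_0,e_{-3},e_{-2},e_{-1}$, where $B(e_i,e_{-i})=1$, $B(e_0,e_0)=1$ and $B$ vanishes on all other pairs of basis vectors. Let $\varepsilon_i$ be the weight of $e_i$, and fix root vectors $g_\alpha$ with $g_{-\alpha}=g_\alpha^{T}$: $g_{\varepsilon_i-\varepsilon_j}=e_i\otimes e_j^*-e_{-j}\otimes e_{-i}^*$, $g_{\varepsilon_i}=\sqrt2\,(e_i\otimes e_0^*-e_0\otimes e_{-i}^*)$, and $g_{\varepsilon_i+\varepsilon_j}=e_i\otimes e_{-j}^*-e_j\otimes e_{-i}^*$ for $i<j$. Let $i(\mathrm{Lie}\,G_2)\subset so(7)$ be the Lie subalgebra generated by $g_{\pm(\varepsilon_1-\varepsilon_2)}+g_{\pm\varepsilon_3}$ and $g_{\pm(\varepsilon_2-\varepsilon_3)}$. Let $\mathfrak p=\mathfrak p_{(1,0,0)}$ be the stabilizer of the line $\mathbb C e_1$ (the conformal parabolic subalgebra), $\mathfrak n_-$ its opposite nilradical (which is commutative), and $i(\mathfrak p')=i(\mathrm{Lie}\,G_2)\cap\mathfrak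 p$. For $\lambda\in\mathbb C$ let $M_\lambda=U(so(7))\otimes_{U(\mathfrak p)}\mathbb C_{\lambda}$ be the generalized Verma module induced from the character of $\mathfrak p$ of weight $\lambda\varepsilon_1$, with highest weight vector $v_\lambda\ne0$. A vector is said to have homogeneity $d$ if it is a linear combination of vectors $X_1\cdots X_d\cdot v_\lambda$ with $X_j\in\mathfrak n_-$. For a parabolic subalgebra $\mathfrak q$ (here $\mathfrak q=\mathfrak p$ in $so(7)$, or $\mathfrak q=i(\mathfrak p')$ in $i(\mathrm{Lie}\,G_2)$) with Levi factor $\mathfrak l$, a vector is $\mathfrak q$-singular (of scalar type) if it is annihilated by the nilradical of $\mathfrak q$ and by $[\mathfrak l,\mathfrak l]$. Put $$u_1=g_{-\varepsilon_1+\varepsilon_2}\,g_{-\varepsilon_1-\varepsilon_2}+g_{-\varepsilon_1-\varepsilon_3}\,g_{-\varepsilon_1+\varepsilon_3},\qquad u_2=(g_{-\varepsilon_1})^2 .$$ **Theorem.** Let $\lambda\in\mathbb C$. The vector $v_\lambda$ is nonzero and is both $\mathfrak p$-singular and $i(\mathfrak p')$-singular. Moreover: 1. Let $N\ge1$ and let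 $A_0,\dots,A_N\in\mathbb C$ be not all zero, and put $u=\sum_{k=0}^N A_k u_1^k u_2^{N-k}$. Then $u\cdot v_\lambda$ is $i(\mathfrak p')$-singular of homogeneity $2N$ if and only if $\lambda=N-\tfrac52$ and $u=c\,(4u_1+u_2)^N$ for some $c\in\mathbb C\setminus\{0\}$. 2. For $N\ge 0$, $M_\lambda$ has no nonzero $i(\mathfrak p')$-singular vector of homogeneity $2N+1$. 3. A vector $v\in M_\lambda$ that is not proportional to $v_\lambda$ is $\mathfrak p$-singular and homogeneous (of some homogeneity $d\ge 0$) if and only if there is an integer $N\ge1$ with $\lambda=N-\tfrac52$ and $v=c\,(4u_1+u_2)^N\cdot v_\lambda$ for some $c\in\mathbb C\setminus\{0\}$. 4. If $\lambda=N-\tfrac52$ with an integer $N\ge1$, that is $\lambda\in\{-\tfrac32,-\tfrac12,\tfrac12,\dots\}$, then $v_\lambda$ and $(4u_1+u_2)^N\cdot v_\lambda$ are linearly independent, and they span both the space of all $i(\mathfrak p')$-singular vectors and the space of all $\mathfrak p$-singular vectors, homogeneous or not. For every other $\lambda$ both of these spaces are equal to $\mathbb C v_\lambda$. -/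

import Mathlib

noncomputable section

namespace G2Verma

attribute [local instance 100] LieRing.ofAssociativeRing

/-! ### The Lie algebra `so(7)`

Rows and columns `0, 1, 2, 3, 4, 5, 6` stand for the basis `e₁, e₂, e₃, e₀, e₋₃, e₋₂, e₋₁` of the
defining space, so that `Fin.rev` exchanges `eᵢ` with `e₋ᵢ` and fixes `e₀`. -/

/-- The Gram matrix of the symmetric bilinear form `B(eᵢ, e₋ᵢ) = 1`, `B(e₀, e₀) = 1`, all other
values on basis vectors being zero. -/
def formMatrix : Matrix (Fin 7) (Fin 7) ℂ :=
  Matrix.of fun i j => if j = Fin.rev i then 1 else 0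

/-- `so(7)`: the matrices `X` with `Xᵀ B + B X = 0`. -/
abbrev So7 : Type := ↥(skewAdjointMatricesLieSubalgebra formMatrix)

/-- The matrix `e_i ⊗ e_j^* - e_{-j} ⊗ e_{-i}^*`. -/
def rootMatrix (i j : Fin 7) : Matrix (Fin 7) (Fin 7) ℂ :=
  Matrix.single i j 1 - Matrix.single (Fin.rev j) (Fin.rev i) 1

theorem rootMatrix_mem (i j : Fin 7) :
    rootMatrix i j ∈ skewAdjointMatricesLieSubalgebra formMatrix := by
  rw [mem_skewAdjointMatricesLieSubalgebra, mem_skewAdjointMatricesSubmodule,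
    Matrix.IsSkewAdjoint, Matrix.IsAdjointPair]
  ext a b
  have hf : ∀ a b : Fin 7, formMatrix a b = if b = Fin.rev a then 1 else 0 := fun _ _ => rfl
  have hf' : ∀ a b : Fin 7, formMatrix a b = if a = Fin.rev b then 1 else 0 := by
    intro a b
    rw [hf]
    congr 1
    exact propext ⟨fun h => by rw [h, Fin.rev_rev], fun h => by rw [h, Fin.rev_rev]⟩
  simp only [Matrix.mul_apply, Matrix.transpose_apply, Matrix.neg_apply]
  simp only [hf a, hf' _ b, mul_ite, ite_mul, mul_one, one_mul, mul_zero, zero_mul,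
    Finset.sum_ite_eq', Finset.mem_univ, if_true]
  simp only [rootMatrix, Matrix.sub_apply, Matrix.single_apply]
  have h1 : ∀ x y : Fin 7, (Fin.rev x = y) = (x = Fin.rev y) := fun x y =>
    propext ⟨fun h => by rw [← h, Fin.rev_rev], fun h => by rw [h, Fin.rev_rev]⟩
  simp only [h1, Fin.rev_rev]
  simp only [and_comm, neg_sub]

/-- `rootMatrix i j` as an element of `so(7)`. -/
def F (i j : Fin 7) : So7 := ⟨rootMatrix i j, rootMatrix_mem i j⟩

/-- The scalar `√2`. -/
def sqrtTwo : ℂ := ((Real.sqrt 2 : ℝ) : ℂ)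

/-! The Chevalley-Weyl root vectors that are needed. The normalization is `g_{-α} = (g_α)ᵀ`. -/

/-- `g_{ε₁ - ε₂}`, a simple root vector. -/
def g1 : So7 := F 0 1
/-- `g_{ε₂ - ε₃}`, a simple root vector. -/
def g2 : So7 := F 1 2
/-- `g_{ε₃} = √2 (e₃ ⊗ e₀^* - e₀ ⊗ e₋₃^*)`, a simple root vector. -/
def g3 : So7 := sqrtTwo • F 2 3
/-- `g_{-ε₁ + ε₂}` (this is `∂/∂x₁`). -/
def gm1 : So7 := F 1 0
/-- `g_{-ε₂ + ε₃}`. -/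
def gm2 : So7 := F 2 1
/-- `g_{-ε₃} = √2 (e₀ ⊗ e₃^* - e₋₃ ⊗ e₀^*)`. -/
def gm3 : So7 := sqrtTwo • F 3 2
/-- `g_{-ε₁ + ε₃}` (this is `∂/∂x₅`). -/
def gm4 : So7 := F 2 0
/-- `g_{-ε₁} = √2 (e₀ ⊗ e₁^* - e₋₁ ⊗ e₀^*)` (this is `∂/∂x₃`). -/
def gm6 : So7 := sqrtTwo • F 3 0
/-- `g_{-ε₁ - ε₃} = e₋₃ ⊗ e₁^* - e₋₁ ⊗ e₃^*` (this is `∂/∂x₂`). -/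
def gm8 : So7 := F 4 0
/-- `g_{-ε₁ - ε₂} = e₋₂ ⊗ e₁^* - e₋₁ ⊗ e₂^*` (this is `∂/∂x₄`). -/
def gm9 : So7 := F 5 0

/-! ### The conformal parabolic subalgebra -/

/-- The conformal parabolic subalgebra `𝔭 = 𝔭_(1,0,0)`: the stabilizer of the line `ℂ e₁`. It is
spanned by the diagonal matrices and the root spaces of all roots whose `ε₁`-coefficient is
nonnegative, that is, only the first simple root `ε₁ - ε₂` is crossed out. -/
def conformalParabolic : LieSubalgebra ℂ So7 where
  carrier := {X | ∀ i, i ≠ 0 → (X : Matrix (Fin 7) (Fin 7) ℂ) i 0 = 0}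
  zero_mem' := by intro i _; rfl
  add_mem' := by
    intro X Y hX hY i hi
    change (X : Matrix (Fin 7) (Fin 7) ℂ) i 0 + (Y : Matrix (Fin 7) (Fin 7) ℂ) i 0 = 0
    rw [hX i hi, hY i hi, add_zero]
  smul_mem' := by
    intro c X hX i hi
    change c * (X : Matrix (Fin 7) (Fin 7) ℂ) i 0 = 0
    rw [hX i hi, mul_zero]
  lie_mem' := by
    intro X Y hX hY i hi
    have key : ∀ A B : So7, (∀ i, i ≠ 0 → (A : Matrix (Fin 7) (Fin 7) ℂ) i 0 = 0) →
        (∀ i, i ≠ 0 → (B : Matrix (Fin 7) (Fin 7) ℂ) i 0 = 0) →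
        ((A : Matrix (Fin 7) (Fin 7) ℂ) * (B : Matrix (Fin 7) (Fin 7) ℂ)) i 0 = 0 := by
      intro A B hA hB
      rw [Matrix.mul_apply]
      refine Finset.sum_eq_zero fun k _ => ?_
      by_cases hk : k = 0
      · rw [hk, hA i hi, zero_mul]
      · rw [hB k hk, mul_zero]
    change ((X : Matrix (Fin 7) (Fin 7) ℂ) * (Y : Matrix (Fin 7) (Fin 7) ℂ)
      - (Y : Matrix (Fin 7) (Fin 7) ℂ) * (X : Matrix (Fin 7) (Fin 7) ℂ)) i 0 = 0
    rw [Matrix.sub_apply, key X Y hX hY, key Y X hY hX, sub_zero]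

/-- The character `χ_λ` of `𝔭` of weight `λ ε₁`: it is `λ` times the eigenvalue on `e₁`. -/
def parabolicCharacter (lam : ℂ) : LieAlgebra.LieCharacter ℂ conformalParabolic where
  toFun X := lam * ((X : So7) : Matrix (Fin 7) (Fin 7) ℂ) 0 0
  map_add' X Y := mul_add lam _ _
  map_smul' c X := mul_left_comm lam c _
  map_lie' := by
    intro X Y
    have key : ∀ A B : conformalParabolic,
        (((A : So7) : Matrix (Fin 7) (Fin 7) ℂ) * ((B : So7) : Matrix (Fin 7) (Fin 7) ℂ)) 0 0
          = ((A : So7) : Matrix (Fin 7) (Fin 7) ℂ) 0 0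
            * ((B : So7) : Matrix (Fin 7) (Fin 7) ℂ) 0 0 := by
      intro A B
      rw [Matrix.mul_apply]
      refine Finset.sum_eq_single 0 (fun k _ hk => ?_) (fun h => absurd (Finset.mem_univ _) h)
      rw [B.2 k hk, mul_zero]
    have h : lam * (((X : So7) : Matrix (Fin 7) (Fin 7) ℂ) * ((Y : So7) : Matrix (Fin 7) (Fin 7) ℂ)
        - ((Y : So7) : Matrix (Fin 7) (Fin 7) ℂ) * ((X : So7) : Matrix (Fin 7) (Fin 7) ℂ)) 0 0
        = 0 := by
      rw [Matrix.sub_apply, key X Y, key Y X]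
      ring
    refine Eq.trans h ?_
    rw [LieRing.of_associative_ring_bracket]
    ring

/-! ### The embedded exceptional Lie algebra and its parabolic subalgebra -/

/-- `i(Lie G₂)`: the Lie subalgebra of `so(7)` generated by the images
`i(g'_{±1}) = g_{±1} + g_{±3}` and `i(g'_{±2}) = g_{±2}` of the simple root vectors. -/
def imageG2 : LieSubalgebra ℂ So7 :=
  LieSubalgebra.lieSpan ℂ So7 {g1 + g3, g2, gm1 + gm3, gm2}

/-- `i(𝔭') = i(Lie G₂) ∩ 𝔭`. -/
def parabolicG2 : LieSubalgebra ℂ So7 := imageG2 ⊓ conformalParabolic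

/-- The grading element `h_{ε₁}` of `𝔭`, which spans the centre of its Levi factor. -/
def gradingSo7 : So7 := F 0 0

/-- The grading element `i(2 h'₁ + h'₂)` of `i(𝔭')`, which spans the centre of its Levi factor;
here `h'₁ = [g'₁, g'₋₁]` and `h'₂ = 3 [g'₂, g'₋₂]`. -/
def gradingG2 : So7 := (2 : ℂ) • ⁅g1 + g3, gm1 + gm3⁆ + (3 : ℂ) • ⁅g2, gm2⁆

/-- The nilradical of a parabolic subalgebra `𝔮` with grading element `H`: the span of the
eigenvectors of `ad H` in `𝔮` with positive (integral) eigenvalue. -/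
def nilradical (H : So7) (𝔮 : LieSubalgebra ℂ So7) : Submodule ℂ So7 :=
  Submodule.span ℂ {X | X ∈ 𝔮 ∧ ∃ k : ℕ, 0 < k ∧ ⁅H, X⁆ = (k : ℂ) • X}

/-- The Levi factor of a parabolic subalgebra `𝔮` with grading element `H`: the centralizer of `H`
in `𝔮`. -/
def levi (H : So7) (𝔮 : LieSubalgebra ℂ So7) : LieSubalgebra ℂ So7 where
  carrier := {X | X ∈ 𝔮 ∧ ⁅H, X⁆ = 0}
  zero_mem' := ⟨𝔮.zero_mem, lie_zero H⟩
  add_mem' := fun hX hY => ⟨𝔮.add_mem hX.1 hY.1, by rw [lie_add, hX.2, hY.2, add_zero]⟩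
  smul_mem' := fun c _ hX => ⟨𝔮.smul_mem c hX.1, by rw [lie_smul, hX.2, smul_zero]⟩
  lie_mem' := fun {X Y} hX hY =>
    ⟨𝔮.lie_mem hX.1 hY.1, by rw [leibniz_lie, hX.2, hY.2, zero_lie, lie_zero, add_zero]⟩

/-! ### The generalized Verma module -/

/-- The universal enveloping algebra `U(so(7))`. -/
abbrev U : Type := UniversalEnvelopingAlgebra ℂ So7

/-- The canonical map `so(7) → U(so(7))`. -/
abbrev toU : So7 →ₗ⁅ℂ⁆ U := UniversalEnvelopingAlgebra.ι ℂ

/-- The left ideal of `U(so(7))` generated by all `X - χ_λ(X)`, `X ∈ 𝔭`. -/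
def vermaIdeal (lam : ℂ) : Submodule U U :=
  Submodule.span U
    (Set.range fun X : conformalParabolic =>
      toU (X : So7) - algebraMap ℂ U (parabolicCharacter lam X))

/-- The generalized Verma module of scalar type
`U(so(7)) ⊗_{U(𝔭)} ℂ_λ = U(so(7)) / U(so(7)) ⟨X - χ_λ(X) : X ∈ 𝔭⟩`. -/
abbrev Verma (lam : ℂ) : Type := U ⧸ vermaIdeal lam

/-- The highest weight vector `v_λ`. -/
def hwv (lam : ℂ) : Verma lam := Submodule.Quotient.mk 1

/-- The opposite nilradical `𝔫₋` of `𝔭`. -/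
def nMinus : Submodule ℂ So7 where
  carrier := {X | ⁅gradingSo7, X⁆ = -X}
  zero_mem' := by simp
  add_mem' := by
    intro X Y (hX : _ = _) (hY : _ = _)
    change ⁅gradingSo7, X + Y⁆ = -(X + Y)
    rw [lie_add, hX, hY, neg_add]
  smul_mem' := by
    intro c X (hX : _ = _)
    change ⁅gradingSo7, c • X⁆ = -(c • X)
    rw [lie_smul, hX, smul_neg]

/-- The vectors of homogeneity `d`: linear combinations of vectors `X₁ ⋯ X_d · v_λ` with
`X₁, …, X_d ∈ 𝔫₋`. -/
def homogeneousPart (lam : ℂ) (d : ℕ) : Submodule ℂ (Verma lam) :=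
  (Submodule.map (toU : So7 →ₗ[ℂ] U) nMinus ^ d).map
    ((LinearMap.toSpanSingleton U (Verma lam) (hwv lam)).restrictScalars ℂ : U →ₗ[ℂ] Verma lam)

/-- The `𝔮`-singular vectors (of scalar type) of the generalized Verma module, for a parabolic
subalgebra `𝔮` with grading element `H`: the vectors annihilated by the nilradical and by the
semisimple part `[𝔩, 𝔩]` of the Levi factor `𝔩`. -/
def singularVectors (lam : ℂ) (H : So7) (𝔮 : LieSubalgebra ℂ So7) :
    Submodule ℂ (Verma lam) where
  carrier := {v | (∀ X ∈ nilradical H 𝔮, toU X • v = 0) ∧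
    ∀ X ∈ levi H 𝔮, ∀ Y ∈ levi H 𝔮, toU ⁅X, Y⁆ • v = 0}
  zero_mem' := ⟨fun _ _ => smul_zero _, fun _ _ _ _ => smul_zero _⟩
  add_mem' := fun hv hw =>
    ⟨fun X hX => by rw [smul_add, hv.1 X hX, hw.1 X hX, add_zero],
      fun X hX Y hY => by rw [smul_add, hv.2 X hX Y hY, hw.2 X hX Y hY, add_zero]⟩
  smul_mem' := fun c v hv =>
    ⟨fun X hX => by rw [smul_comm, hv.1 X hX, smul_zero],
      fun X hX Y hY => by rw [smul_comm, hv.2 X hX Y hY, smul_zero]⟩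

/-- The `so(7) ∩ 𝔭`-singular vectors. -/
def singularSo7 (lam : ℂ) : Submodule ℂ (Verma lam) :=
  singularVectors lam gradingSo7 conformalParabolic

/-- The `i(Lie G₂) ∩ 𝔭`-singular vectors. -/
def singularG2 (lam : ℂ) : Submodule ℂ (Verma lam) :=
  singularVectors lam gradingG2 parabolicG2

/-! ### The invariants -/

/-- `u₁ = g₋₁ g₋₉ + g₋₈ g₋₄`. -/
def u1 : U := toU gm1 * toU gm9 + toU gm8 * toU gm4

/-- `u₂ = (g₋₆)²`. -/
def u2 : U := toU gm6 ^ 2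

/-- The vector `(4 u₁ + u₂)^N · v_λ`. -/
def specialVector (lam : ℂ) (N : ℕ) : Verma lam := ((4 : ℂ) • u1 + u2) ^ N • hwv lam

end G2Verma

end

noncomputable section

namespace G2Verma

attribute [local instance] LieRing.ofAssociativeRing

open MvPolynomial

/-! Because `𝔫₋` is commutative, `M_λ` can be modelled on polynomials in five variables: `𝔫₋` acts
by multiplication, the Levi factor by first-order operators, and the nilradical of `𝔭` by the
second-order operators `conformalOp`. The formulas are forced by `[A, Xᵢ]`; `act_lie` checks that
they give a representation, and `toPoly_polyToU` with `polyToU_toPoly` shows that the model is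
faithful.

Upper bound. Every singular vector of either kind is killed by `g2`, `gm2` and `g1 + g3`, and these
three conditions already suffice. The first two generate an `sl₂` whose invariants are the
polynomials in `X₂` and `X₀X₄ + X₁X₃`; in particular invariants have weight `0` for the sum of the
`ε₂`- and `ε₃`-coefficients. For this weight `g1` has degree `-1` and `g3` has degree `+1`, so on an
invariant the equation for `g1 + g3` splits into one for `g1` and one for `g3`. This is why
`G₂`-singular vectors turn out to be `so(7)`-singular. Killing by `g3` leaves only polynomials
`q(Q)` in the invariant quadric `Q`, and killing by `g1` becomes the radial equation `(λ + 3/2) q' =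
t q''` (`exists_eq_aeval_quadric`). A monomial `t^N` with `N ≥ 1` solves it exactly when `λ = N -
5/2`.

Lower bound. `Q` is invariant under the semisimple part of the Levi factor (`leviDer_quadric`), and
`Q^N` is killed by all `conformalOp` at `λ = N - 5/2` (`conformalOp_quadric_pow`). Thus the whole
kernel of the character on `𝔭` kills it, and that kernel contains what is needed for both parabolic
subalgebras (`mem_singularVectors`). As `4u₁ + u₂` corresponds to `4Q`, every claim can be read off
from polynomials. -/

/-- Polynomial functions in the coordinates `∂/∂xᵢ` of the opposite nilradical. -/
abbrev Poly5 : Type := MvPolynomial (Fin 5) ℂ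

/-! ### Conformal second-order operators and the invariant quadric. -/

/-- The Euler operator. -/
def euler : Derivation ℂ Poly5 Poly5 := mkDerivation ℂ X

/-- The Laplace operator of the invariant form on the opposite nilradical. -/
def laplacian : Poly5 →ₗ[ℂ] Poly5 :=
  ∑ k : Fin 5, (pderiv k : Derivation ℂ Poly5 Poly5).toLinearMap ∘ₗ
    (pderiv k.rev : Derivation ℂ Poly5 Poly5).toLinearMap

theorem laplacian_apply (f : Poly5) :
    laplacian f = ∑ k : Fin 5, pderiv k (pderiv k.rev f) := by
  simp [laplacian]

/-- The invariant quadric `X₀X₄ + X₁X₃ + X₂²/2`. -/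
def quadric : Poly5 := X 0 * X 4 + X 1 * X 3 + C 2⁻¹ * X 2 ^ 2

/-- The second order operators by which the nilradical of `𝔭` acts. -/
def conformalOp (lam : ℂ) (i : Fin 5) : Poly5 →ₗ[ℂ] Poly5 :=
  lam • (pderiv i : Derivation ℂ Poly5 Poly5).toLinearMap
    - euler.toLinearMap ∘ₗ (pderiv i : Derivation ℂ Poly5 Poly5).toLinearMap
    + LinearMap.mulLeft ℂ (C 2⁻¹ * X i.rev) ∘ₗ laplacian

theorem conformalOp_apply (lam : ℂ) (i : Fin 5) (f : Poly5) :
    conformalOp lam i f =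
      C lam * pderiv i f - euler (pderiv i f) + C 2⁻¹ * X i.rev * laplacian f := by
  simp [conformalOp, smul_eq_C_mul, -map_inv₀, mul_assoc]

theorem euler_X (i : Fin 5) : euler (X i) = X i := mkDerivation_X _ _ _

theorem euler_X_mul (i : Fin 5) (f : Poly5) : euler (X i * f) = X i * f + X i * euler f := by
  rw [Derivation.leibniz, euler_X, smul_eq_mul, smul_eq_mul]; ring

theorem laplacian_X_mul (i : Fin 5) (f : Poly5) :
    laplacian (X i * f) = X i * laplacian f + 2 * pderiv i.rev f := by
  have h : ∀ k : Fin 5, pderiv k (pderiv k.rev (X i * f)) =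
      X i * pderiv k (pderiv k.rev f) + (if k.rev = i then pderiv k f else 0)
        + (if k = i then pderiv k.rev f else 0) := by
    intro k
    rw [pderiv_mul, map_add, pderiv_mul, pderiv_mul]
    rcases eq_or_ne k i with h1 | h1 <;> rcases eq_or_ne k.rev i with h2 | h2
    · rw [h2, h1, pderiv_X_self, if_pos rfl, pderiv_one]; ring
    · rw [pderiv_X_of_ne h2.symm, h1, pderiv_X_self, if_neg (h1 ▸ h2), if_pos rfl, map_zero]; ring
    · rw [h2, pderiv_X_self, pderiv_X_of_ne h1.symm, if_pos rfl, if_neg h1, pderiv_one]; ring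
    · rw [pderiv_X_of_ne h2.symm, pderiv_X_of_ne h1.symm, if_neg h1, if_neg h2, map_zero]; ring
  have h3 : ∀ k : Fin 5, (k.rev = i) = (k = i.rev) := fun k =>
    propext ⟨fun h => by rw [← h, Fin.rev_rev], fun h => by rw [h, Fin.rev_rev]⟩
  rw [laplacian_apply, laplacian_apply, Finset.sum_congr rfl fun k _ => h k]
  simp only [h3, Finset.sum_add_distrib, Finset.sum_ite_eq', Finset.mem_univ, if_true,
    ← Finset.mul_sum]
  ring

/-- The commutator with multiplication by `Xᵢ` is first order: it is the Levi element `[n₊, n₋]` in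
the model, which is what makes `actFun_X_mul` work. -/
theorem conformalOp_X_mul (lam : ℂ) (k i : Fin 5) (f : Poly5) :
    conformalOp lam k (X i * f) = X i * conformalOp lam k f
      + (if i = k then C lam * f - euler f else 0) - X i * pderiv k f
      + X k.rev * pderiv i.rev f := by
  have hC : (C 2⁻¹ : Poly5) * 2 = 1 := by
    rw [show (2 : Poly5) = C 2 from rfl, ← C_mul]; norm_num
  rw [conformalOp_apply, conformalOp_apply, laplacian_X_mul, pderiv_mul]
  rcases eq_or_ne i k with rfl | h
  · rw [pderiv_X_self, if_pos rfl, one_mul, map_add, euler_X_mul]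
    linear_combination (X i.rev * pderiv i.rev f) * hC
  · rw [pderiv_X_of_ne h, if_neg h, zero_mul, zero_add, euler_X_mul]
    linear_combination (X k.rev * pderiv i.rev f) * hC

theorem conformalOp_one (lam : ℂ) (i : Fin 5) : conformalOp lam i 1 = 0 := by
  simp [conformalOp_apply, laplacian_apply]

theorem pderiv_quadric (i : Fin 5) : pderiv i quadric = X i.rev := by
  have hC : (C 2⁻¹ : Poly5) * 2 = 1 := by
    rw [show (2 : Poly5) = C 2 from rfl, ← C_mul]; norm_num
  fin_cases i <;>
    simp [quadric, pderiv_X, Fin.rev]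
  linear_combination X 2 * hC

theorem euler_quadric : euler quadric = 2 * quadric := by
  simp [quadric, euler, mkDerivation_X]
  ring

theorem sum_X_mul_X_rev : ∑ k : Fin 5, (X k : Poly5) * X k.rev = 2 * quadric := by
  have hC : (C 2⁻¹ : Poly5) * 2 = 1 := by
    rw [show (2 : Poly5) = C 2 from rfl, ← C_mul]; norm_num
  rw [Fin.sum_univ_five, quadric]
  change (X 0 * X 4 + X 1 * X 3 + X 2 * X 2 + X 3 * X 1 + X 4 * X 0 : Poly5) = _
  linear_combination (- X 2 ^ 2) * hC

theorem pderiv_aeval_quadric (i : Fin 5) (q : Polynomial ℂ) :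
    pderiv i (Polynomial.aeval quadric q)
      = X i.rev * Polynomial.aeval quadric (Polynomial.derivative q) := by
  rw [Derivation.map_aeval, pderiv_quadric, smul_eq_mul, mul_comm]

/-- On radial polynomials the operators reduce to one ordinary differential operator. The constant
is `3/2 = 5/2 - 1`: half the dimension from the Laplacian, minus one from the Euler operator acting
on the factor `X i.rev`. -/
theorem conformalOp_aeval_quadric (lam : ℂ) (i : Fin 5) (q : Polynomial ℂ) :
    conformalOp lam i (Polynomial.aeval quadric q) =
      X i.rev * Polynomial.aeval quadric
        (Polynomial.C (lam + 3 / 2) * Polynomial.derivative q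
          - Polynomial.X * Polynomial.derivative (Polynomial.derivative q)) := by
  have hL : laplacian (Polynomial.aeval quadric q) =
      5 * Polynomial.aeval quadric (Polynomial.derivative q) + 2 * quadric *
        Polynomial.aeval quadric (Polynomial.derivative (Polynomial.derivative q)) := by
    have h : ∀ k : Fin 5, pderiv k (pderiv k.rev (Polynomial.aeval quadric q)) =
        Polynomial.aeval quadric (Polynomial.derivative q) + X k * X k.rev *
          Polynomial.aeval quadric (Polynomial.derivative (Polynomial.derivative q)) := by
      intro k
      rw [pderiv_aeval_quadric, Fin.rev_rev, pderiv_mul, pderiv_X_self, pderiv_aeval_quadric]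
      ring
    rw [laplacian_apply, Finset.sum_congr rfl fun k _ => h k, Finset.sum_add_distrib,
      ← Finset.sum_mul, sum_X_mul_X_rev]
    simp
  have hC : (C 2⁻¹ : Poly5) * 2 = 1 := by
    rw [show (2 : Poly5) = C 2 from rfl, ← C_mul]; norm_num
  have hC' : (C (lam + 3 / 2) : Poly5) = C lam + 3 * C 2⁻¹ := by
    rw [show (3 : Poly5) = C 3 from rfl, ← C_mul, ← C_add]; rfl
  rw [conformalOp_apply, hL, pderiv_aeval_quadric, euler_X_mul, Derivation.map_aeval,
    euler_quadric, smul_eq_mul, map_sub, map_mul, map_mul, Polynomial.aeval_X,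
    Polynomial.aeval_C, algebraMap_eq, hC']
  linear_combination (X i.rev * Polynomial.aeval quadric (Polynomial.derivative q) +
    X i.rev * quadric *
      Polynomial.aeval quadric (Polynomial.derivative (Polynomial.derivative q))) * hC

/-! ### Polynomials annihilated by `i(𝔭')` -/

/-- The action of `g_{ε₂ - ε₃}`. -/
def longRaise : Derivation ℂ Poly5 Poly5 := mkDerivation ℂ ![0, X 0, 0, 0, -X 3]

/-- The action of `g_{-ε₂ + ε₃}`. -/
def longLower : Derivation ℂ Poly5 Poly5 := mkDerivation ℂ ![X 1, 0, 0, -X 4, 0]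

/-- The action of `g_{ε₃} / √2`. -/
def shortRaise : Derivation ℂ Poly5 Poly5 := mkDerivation ℂ ![0, 0, X 1, -X 2, 0]

/-- The weight with respect to `ε₂ + ε₃`. -/
def torusWeight : Derivation ℂ Poly5 Poly5 := mkDerivation ℂ ![X 0, X 1, 0, -X 3, -X 4]

/-- Chain rule along a polynomial integral curve `γ` of `D`; both sides follow the Leibniz rule, so
generators suffice. -/
theorem derivative_aeval_of_flow {σ : Type*}
    (D : Derivation ℂ (MvPolynomial σ ℂ) (MvPolynomial σ ℂ))
    (γ : σ → Polynomial ℂ) (hγ : ∀ i, Polynomial.derivative (γ i) = aeval γ (D (X i)))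
    (f : MvPolynomial σ ℂ) : Polynomial.derivative (aeval γ f) = aeval γ (D f) := by
  induction f using MvPolynomial.induction_on with
  | C a => simp
  | add p q hp hq => simp [hp, hq]
  | mul_X p i hp =>
    simp only [map_mul, aeval_X, Polynomial.derivative_mul, hp, hγ, Derivation.leibniz, map_add,
      smul_eq_mul]
    ring

/-- The root vectors act by nilpotent vector fields, whose integral curves are polynomial in time. A
function killed by the field is therefore constant along them, which turns Lie algebra invariance
into invariance under one-parameter groups. -/
theorem eval_eq_of_flow {σ : Type*} (D : Derivation ℂ (MvPolynomial σ ℂ) (MvPolynomial σ ℂ))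
    (γ : σ → Polynomial ℂ) (hγ : ∀ i, Polynomial.derivative (γ i) = aeval γ (D (X i)))
    {f : MvPolynomial σ ℂ} (hf : D f = 0) (t : ℂ) :
    eval (fun i => (γ i).eval t) f = eval (fun i => (γ i).eval 0) f := by
  have h1 : ∀ t : ℂ, eval (fun i => (γ i).eval t) f = (aeval γ f).eval t := by
    intro t
    clear hf
    induction f using MvPolynomial.induction_on with
    | C a => simp
    | add p q hp hq => simp [hp, hq]
    | mul_X p i hp => simp [hp]
  have h2 : aeval γ f = Polynomial.C ((aeval γ f).coeff 0) :=
    Polynomial.eq_C_of_derivative_eq_zero (by rw [derivative_aeval_of_flow D γ hγ, hf, map_zero])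
  rw [h1, h1, h2, Polynomial.eval_C, Polynomial.eval_C]


theorem eval_longRaise {f : Poly5} (hf : longRaise f = 0) (a b c d e t : ℂ) :
    eval ![a, b + t * a, c, d, e - t * d] f = eval ![a, b, c, d, e] f := by
  have h := eval_eq_of_flow longRaise
    ![Polynomial.C a, Polynomial.C b + Polynomial.X * Polynomial.C a, Polynomial.C c,
      Polynomial.C d, Polynomial.C e - Polynomial.X * Polynomial.C d]
    (by intro i; fin_cases i <;> simp [longRaise, mkDerivation_X]) hf t
  convert h using 2 <;>
  · congr 1; funext i; fin_cases i <;> simp <;> ring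

theorem eval_longLower {f : Poly5} (hf : longLower f = 0) (a b c d e t : ℂ) :
    eval ![a + t * b, b, c, d - t * e, e] f = eval ![a, b, c, d, e] f := by
  have h := eval_eq_of_flow longLower
    ![Polynomial.C a + Polynomial.X * Polynomial.C b, Polynomial.C b, Polynomial.C c,
      Polynomial.C d - Polynomial.X * Polynomial.C e, Polynomial.C e]
    (by intro i; fin_cases i <;> simp [longLower, mkDerivation_X]) hf t
  convert h using 2 <;>
  · congr 1; funext i; fin_cases i <;> simp <;> ring

theorem eval_shortRaise {f : Poly5} (hf : shortRaise f = 0) (a b c d e t : ℂ) :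
    eval ![a, b, c + t * b, d - t * c - t ^ 2 * b / 2, e] f = eval ![a, b, c, d, e] f := by
  have h := eval_eq_of_flow shortRaise
    ![Polynomial.C a, Polynomial.C b, Polynomial.C c + Polynomial.X * Polynomial.C b,
      Polynomial.C d - Polynomial.X * Polynomial.C c - Polynomial.X ^ 2 * Polynomial.C (b / 2),
      Polynomial.C e]
    (by
      intro i
      fin_cases i <;> simp [shortRaise, mkDerivation_X, Polynomial.derivative_pow]
      have hb : Polynomial.C b = 2 * Polynomial.C (b / 2) := by
        rw [show (2 : Polynomial ℂ) = Polynomial.C 2 from rfl, ← Polynomial.C_mul]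
        congr 1; ring
      rw [show (Polynomial.C 2 : Polynomial ℂ) = 2 from rfl, hb]; ring) hf t
  convert h using 2
  · congr 1; funext i; fin_cases i <;> simp <;> ring
  · congr 1; funext i; fin_cases i <;> simp

theorem eval_aeval_eq {σ τ : Type*} (g : σ → MvPolynomial τ ℂ) (x : τ → ℂ)
    (f : MvPolynomial σ ℂ) : eval x (aeval g f) = eval (fun i => eval x (g i)) f := by
  induction f using MvPolynomial.induction_on with
  | C a => simp
  | add p q hp hq => simp only [map_add, hp, hq]
  | mul_X p i hp => simp only [map_mul, hp, aeval_X, eval_X]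

/-- Four elementary `SL₂` moves bring a generic point to a normal form: make the second coordinate
`1`, then the first `1`, then the second `0`, then the fourth `0`. The last coordinate ends as the
invariant `ae + bd`. -/
theorem eval_eq_of_sl2_invariant_of_ne {f : Poly5} (h1 : longRaise f = 0) (h2 : longLower f = 0)
    {a b c d e : ℂ} (ha : a ≠ 0) (hu : a * e + b * d ≠ 0) :
    eval ![a, b, c, d, e] f = eval ![1, 0, c, 0, a * e + b * d] f := by
  have s1 := eval_longRaise h1 a b c d e ((1 - b) / a)
  have s2 := eval_longLower h2 a 1 c d (e - (1 - b) / a * d) (1 - a)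
  have s3 := eval_longRaise h1 1 1 c (d - (1 - a) * (e - (1 - b) / a * d))
    (e - (1 - b) / a * d) (-1)
  have s4 := eval_longLower h2 1 0 c (d - (1 - a) * (e - (1 - b) / a * d))
    (a * e + b * d) ((d - (1 - a) * (e - (1 - b) / a * d)) / (a * e + b * d))
  rw [show b + (1 - b) / a * a = 1 by field_simp; ring] at s1
  rw [show a + (1 - a) * 1 = 1 by ring] at s2
  rw [show (1 : ℂ) + -1 * 1 = 0 by ring,
    show e - (1 - b) / a * d - -1 * (d - (1 - a) * (e - (1 - b) / a * d)) = a * e + b * d by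
      field_simp; ring] at s3
  rw [div_mul_cancel₀ _ hu, sub_self, mul_zero, add_zero] at s4
  rw [← s1, ← s2, ← s3, ← s4]

/-- Polynomials annihilated by `sl₂` are polynomials in `X₀X₄ + X₁X₃` and `X₂`. -/
theorem eq_aeval_of_sl2_invariant {f : Poly5} (h1 : longRaise f = 0) (h2 : longLower f = 0) :
    f = aeval (![1, 0, X 2, 0, X 0 * X 4 + X 1 * X 3] : Fin 5 → Poly5) f := by
  -- The normal form is reached only off the zero set of this factor; multiplying by it gives an
  -- identity at all points, and the factor cancels in a domain.
  have key : (f - aeval (![1, 0, X 2, 0, X 0 * X 4 + X 1 * X 3] : Fin 5 → Poly5) f)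
      * (X 0 * (X 0 * X 4 + X 1 * X 3)) = 0 := by
    refine MvPolynomial.funext fun x => ?_
    obtain ⟨a, b, c, d, e, rfl⟩ : ∃ a b c d e, x = ![a, b, c, d, e] :=
      ⟨x 0, x 1, x 2, x 3, x 4, by ext i; fin_cases i <;> rfl⟩
    have hg : (fun i => eval ![a, b, c, d, e]
        ((![1, 0, X 2, 0, X 0 * X 4 + X 1 * X 3] : Fin 5 → Poly5) i))
        = ![1, 0, c, 0, a * e + b * d] := by
      funext i; fin_cases i <;> simp
    rw [map_mul, map_sub, eval_aeval_eq, hg, map_zero]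
    by_cases ha : a = 0
    · simp [ha]
    by_cases hu : a * e + b * d = 0
    · simp [hu]
    rw [eval_eq_of_sl2_invariant_of_ne h1 h2 ha hu, sub_self, zero_mul]
  have hne : (X 0 * (X 0 * X 4 + X 1 * X 3) : Poly5) ≠ 0 := by
    intro h
    have := congrArg (eval ![1, 0, 0, 0, 1]) h
    simp at this
  exact sub_eq_zero.1 ((mul_eq_zero.1 key).resolve_right hne)

theorem eval_eq_of_sl2_invariant {f : Poly5} (h1 : longRaise f = 0) (h2 : longLower f = 0)
    (a b c d e : ℂ) : eval ![a, b, c, d, e] f = eval ![1, 0, c, 0, a * e + b * d] f := by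
  have h := congrArg (eval ![a, b, c, d, e]) (eq_aeval_of_sl2_invariant h1 h2)
  rw [eval_aeval_eq] at h
  rw [h]
  congr 1
  congr 1
  funext i; fin_cases i <;> simp

theorem derivation_aeval_eq_zero {σ τ : Type*}
    (D : Derivation ℂ (MvPolynomial τ ℂ) (MvPolynomial τ ℂ)) (g : σ → MvPolynomial τ ℂ)
    (hg : ∀ i, D (g i) = 0) (f : MvPolynomial σ ℂ) : D (aeval g f) = 0 := by
  induction f using MvPolynomial.induction_on with
  | C a => simp
  | add p q hp hq => rw [map_add, map_add, hp, hq, add_zero]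
  | mul_X p i hp => rw [map_mul, aeval_X, Derivation.leibniz, hp, hg, smul_zero, smul_zero, add_zero]

theorem torusWeight_eq_zero_of_sl2_invariant {f : Poly5} (h1 : longRaise f = 0)
    (h2 : longLower f = 0) : torusWeight f = 0 := by
  rw [eq_aeval_of_sl2_invariant h1 h2]
  refine derivation_aeval_eq_zero _ _ (fun i => ?_) f
  fin_cases i <;> simp [torusWeight, mkDerivation_X]
  ring

/-- Eigenvectors for the distinct eigenvalues `-1` and `1` are independent. This separates `g1` from
`g3`. -/
theorem eq_zero_of_add_eq_zero_of_weight {a b : Poly5} (ha : torusWeight a = -a)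
    (hb : torusWeight b = b) (h : a + b = 0) : a = 0 ∧ b = 0 := by
  have h' : -a + b = 0 := by rw [← ha, ← hb, ← map_add, h, map_zero]
  have h2 : (2 : ℂ) • b = 0 := by rw [two_smul]; linear_combination h + h'
  have hb0 : b = 0 := (smul_eq_zero.1 h2).resolve_left two_ne_zero
  exact ⟨by rw [hb0, add_zero] at h; exact h, hb0⟩

theorem torusWeight_pderiv (k : Fin 5) (f : Poly5) :
    torusWeight (pderiv k f) = pderiv k (torusWeight f)
      - C ((![1, 1, 0, -1, -1] : Fin 5 → ℂ) k) * pderiv k f := by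
  have h : ⁅torusWeight, (pderiv k : Derivation ℂ Poly5 Poly5)⁆
      = -((![1, 1, 0, -1, -1] : Fin 5 → ℂ) k • pderiv k) := by
    refine derivation_ext fun i => ?_
    rw [Derivation.commutator_apply]
    fin_cases k <;> fin_cases i <;> simp [torusWeight, mkDerivation_X, pderiv_X]
  have h' := congrArg (fun D : Derivation ℂ Poly5 Poly5 => D f) h
  simp only [Derivation.commutator_apply, Derivation.neg_apply, Derivation.smul_apply,
    smul_eq_C_mul] at h'
  linear_combination h'

theorem torusWeight_euler (f : Poly5) : torusWeight (euler f) = euler (torusWeight f) := by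
  have h : ⁅torusWeight, euler⁆ = 0 := by
    refine derivation_ext fun i => ?_
    rw [Derivation.commutator_apply]
    fin_cases i <;> simp [torusWeight, euler, mkDerivation_X]
  have h' := congrArg (fun D : Derivation ℂ Poly5 Poly5 => D f) h
  simp only [Derivation.commutator_apply, Derivation.zero_apply] at h'
  linear_combination h'

theorem torusWeight_shortRaise (f : Poly5) :
    torusWeight (shortRaise f) = shortRaise (torusWeight f) + shortRaise f := by
  have h : ⁅torusWeight, shortRaise⁆ = shortRaise := by
    refine derivation_ext fun i => ?_
    rw [Derivation.commutator_apply]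
    fin_cases i <;> simp [torusWeight, shortRaise, mkDerivation_X]
  have h' := congrArg (fun D : Derivation ℂ Poly5 Poly5 => D f) h
  simp only [Derivation.commutator_apply] at h'
  linear_combination h'

theorem torusWeight_laplacian (f : Poly5) :
    torusWeight (laplacian f) = laplacian (torusWeight f) := by
  rw [laplacian_apply, laplacian_apply, map_sum]
  refine Finset.sum_congr rfl fun k _ => ?_
  rw [torusWeight_pderiv, torusWeight_pderiv, map_sub, pderiv_C_mul, sub_sub, ← add_mul, ← C_add]
  fin_cases k <;> simp [Fin.rev]

theorem derivation_C_mul_eq (D : Derivation ℂ Poly5 Poly5) (a : ℂ) (f : Poly5) :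
    D (C a * f) = C a * D f := by
  rw [C_mul', Derivation.map_smul, C_mul']

/-- The operator represents `g_{ε₁ - ε₂}`, whose weight is `-1`. -/
theorem torusWeight_conformalOp (lam : ℂ) {f : Poly5} (hf : torusWeight f = 0) :
    torusWeight (conformalOp lam 0 f) = -conformalOp lam 0 f := by
  have h0 : torusWeight (pderiv 0 f) = - pderiv 0 f := by
    rw [torusWeight_pderiv, hf]; simp
  have h4 : torusWeight (X (Fin.rev 0)) = - X (Fin.rev 0) := by
    change torusWeight (X 4) = - X 4
    simp [torusWeight, mkDerivation_X]
  rw [conformalOp_apply, map_add, map_sub, derivation_C_mul_eq, torusWeight_euler, h0,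
    mul_assoc, derivation_C_mul_eq, Derivation.leibniz, h4, torusWeight_laplacian, hf]
  simp only [map_neg, map_zero, smul_eq_mul]
  ring

theorem eq_aeval_quadric {f : Poly5} (h1 : longRaise f = 0) (h2 : longLower f = 0)
    (h3 : shortRaise f = 0) :
    f = Polynomial.aeval quadric (aeval ![1, 0, 0, 0, (Polynomial.X : Polynomial ℂ)] f) := by
  have hev : ∀ (x : Fin 5 → ℂ), eval x
      (Polynomial.aeval quadric (aeval ![1, 0, 0, 0, (Polynomial.X : Polynomial ℂ)] f))
      = eval ![1, 0, 0, 0, eval x quadric] f := by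
    intro x
    clear h1 h2 h3
    induction f using MvPolynomial.induction_on with
    | C a => simp
    | add p q hp hq => simp only [map_add, hp, hq]
    | mul_X p i hp =>
      simp only [map_mul, hp, aeval_X, eval_X]
      congr 1
      fin_cases i <;> simp
  -- Invariance lets one move to the point `(1, 0, 0, 0, Q(x))` when the second coordinate is
  -- nonzero; the factor `X 1` covers the remaining points.
  have key : (f - Polynomial.aeval quadric
      (aeval ![1, 0, 0, 0, (Polynomial.X : Polynomial ℂ)] f)) * X 1 = 0 := by
    refine MvPolynomial.funext fun x => ?_
    rw [map_mul, map_sub, hev]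
    obtain ⟨a, b, c, d, e, rfl⟩ : ∃ a b c d e, x = ![a, b, c, d, e] :=
      ⟨x 0, x 1, x 2, x 3, x 4, by ext i; fin_cases i <;> rfl⟩
    by_cases hb : b = 0
    · simp [hb]
    -- This flow time makes the third coordinate vanish; the `sl₂` invariant there then equals the
    -- value of the quadric.
    have s1 := eval_shortRaise h3 a b c d e (-c / b)
    rw [eval_eq_of_sl2_invariant h1 h2, show c + -c / b * b = 0 by field_simp; ring,
      show a * e + b * (d - -c / b * c - (-c / b) ^ 2 * b / 2) = a * e + b * d + 2⁻¹ * c ^ 2 by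
        field_simp; ring] at s1
    rw [← s1]
    simp [quadric]
  have hne : (X 1 : Poly5) ≠ 0 := X_ne_zero 1
  exact sub_eq_zero.1 ((mul_eq_zero.1 key).resolve_right hne)

theorem aeval_quadric_injective : Function.Injective
    (Polynomial.aeval quadric : Polynomial ℂ →ₐ[ℂ] Poly5) := by
  -- The left inverse is restriction to the line `(1, 0, 0, 0, t)`, on which the quadric is `t`.
  refine Function.LeftInverse.injective
    (g := (aeval ![1, 0, 0, 0, (Polynomial.X : Polynomial ℂ)] : Poly5 →ₐ[ℂ] _)) fun q => ?_
  change ((aeval ![1, 0, 0, 0, (Polynomial.X : Polynomial ℂ)] : Poly5 →ₐ[ℂ] _).comp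
    (Polynomial.aeval quadric)) q = AlgHom.id ℂ _ q
  congr 1
  ext
  simp [quadric]

/-- The weight argument splits `h3` into two equations; the short root then forces `f` to be radial,
and the conformal operator gives the radial equation. -/
theorem exists_eq_aeval_quadric {lam r : ℂ} (hr : r ≠ 0) {f : Poly5} (h1 : longRaise f = 0)
    (h2 : longLower f = 0) (h3 : conformalOp lam 0 f + r • shortRaise f = 0) :
    ∃ q : Polynomial ℂ, f = Polynomial.aeval quadric q ∧
      Polynomial.C (lam + 3 / 2) * Polynomial.derivative q
          = Polynomial.X * Polynomial.derivative (Polynomial.derivative q) := by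
  have ht := torusWeight_eq_zero_of_sl2_invariant h1 h2
  obtain ⟨hc, hs⟩ := eq_zero_of_add_eq_zero_of_weight (torusWeight_conformalOp lam ht)
    (by rw [Derivation.map_smul, torusWeight_shortRaise, ht, map_zero, zero_add]) h3
  have hs' := (smul_eq_zero.1 hs).resolve_left hr
  have hf := eq_aeval_quadric h1 h2 hs'
  refine ⟨_, hf, ?_⟩
  rw [hf, conformalOp_aeval_quadric] at hc
  have := (mul_eq_zero.1 hc).resolve_left (X_ne_zero _)
  exact sub_eq_zero.1 (aeval_quadric_injective (by rw [this, map_zero]))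

/-! ### Polynomial solutions of the radial equation. -/

/-- Comparing coefficients of `t^(n-1)` gives `n (λ + 3/2 - (n - 1)) qₙ = 0`. The constant term is
always free. -/
theorem coeff_eq_zero_of_radial {lam : ℂ} {q : Polynomial ℂ}
    (h : Polynomial.C (lam + 3 / 2) * Polynomial.derivative q
          = Polynomial.X * Polynomial.derivative (Polynomial.derivative q))
    {n : ℕ} (hn : 0 < n) (hlam : lam ≠ n - 5 / 2) : q.coeff n = 0 := by
  obtain ⟨m, rfl⟩ := Nat.exists_eq_add_of_lt hn
  have h' := congrArg (fun p => Polynomial.coeff p m) h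
  have hm : (Polynomial.X * Polynomial.derivative (Polynomial.derivative q)).coeff m
      = q.coeff (m + 1) * (m + 1) * m := by
    cases m with
    | zero => simp
    | succ m =>
      rw [Polynomial.coeff_X_mul, Polynomial.coeff_derivative, Polynomial.coeff_derivative]
      push_cast; ring
  simp only [hm, Polynomial.coeff_C_mul, Polynomial.coeff_derivative] at h'
  rw [zero_add]
  have h1 : q.coeff (m + 1) * ((m + 1) * (lam + 3 / 2 - m)) = 0 := by linear_combination h'
  refine (mul_eq_zero.1 h1).resolve_right (mul_ne_zero (by exact_mod_cast m.succ_ne_zero) ?_)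
  intro h2
  apply hlam
  push_cast
  linear_combination h2

theorem eq_C_of_radial {lam : ℂ} {q : Polynomial ℂ}
    (h : Polynomial.C (lam + 3 / 2) * Polynomial.derivative q
          = Polynomial.X * Polynomial.derivative (Polynomial.derivative q))
    (hlam : ∀ n : ℕ, 0 < n → lam ≠ n - 5 / 2) : ∃ a, q = Polynomial.C a := by
  refine ⟨q.coeff 0, Polynomial.ext fun n => ?_⟩
  rw [Polynomial.coeff_C]
  split_ifs with hn
  · rw [hn]
  · exact coeff_eq_zero_of_radial h (Nat.pos_of_ne_zero hn) (hlam n (Nat.pos_of_ne_zero hn))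

theorem eq_C_add_of_radial {lam : ℂ} {q : Polynomial ℂ}
    (h : Polynomial.C (lam + 3 / 2) * Polynomial.derivative q
          = Polynomial.X * Polynomial.derivative (Polynomial.derivative q))
    {N : ℕ} (hN : 0 < N) (hlam : lam = N - 5 / 2) :
    ∃ a b, q = Polynomial.C a + Polynomial.C b * Polynomial.X ^ N := by
  refine ⟨q.coeff 0, q.coeff N, Polynomial.ext fun n => ?_⟩
  rw [Polynomial.coeff_add, Polynomial.coeff_C, Polynomial.coeff_C_mul, Polynomial.coeff_X_pow]
  rcases eq_or_ne n 0 with rfl | hn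
  · simp [hN.ne]
  rcases eq_or_ne n N with rfl | hnN
  · simp [hn]
  · rw [coeff_eq_zero_of_radial h (Nat.pos_of_ne_zero hn)
      (by rw [hlam]; intro h; exact hnN (by exact_mod_cast (sub_left_inj.1 h).symm))]
    simp [hn, hnN]

theorem conformalOp_quadric_pow {lam : ℂ} {N : ℕ} (hlam : lam = N - 5 / 2)
    (i : Fin 5) : conformalOp lam i (quadric ^ N) = 0 := by
  have h := conformalOp_aeval_quadric lam i (Polynomial.X ^ N)
  rw [map_pow, Polynomial.aeval_X] at h
  rw [h]
  have : Polynomial.C (lam + 3 / 2) * Polynomial.derivative (Polynomial.X ^ N)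
      - Polynomial.X * Polynomial.derivative (Polynomial.derivative (Polynomial.X ^ N)) = 0 := by
    have hc : Polynomial.C (lam + 3 / 2) = (N : Polynomial ℂ) - 1 := by
      rw [hlam, ← Polynomial.C_eq_natCast, ← Polynomial.C_1, ← Polynomial.C_sub]
      congr 1; ring
    rw [hc]
    -- The exponents `N - 1` and `N - 2` are truncated subtractions, so `N = 0` and `N = 1` are
    -- treated apart.
    rcases N with _ | _ | N <;> simp
    ring
  rw [this, map_zero, mul_zero]

theorem isHomogeneous_quadric : quadric.IsHomogeneous 2 :=
  (((isHomogeneous_X ℂ 0).mul (isHomogeneous_X ℂ 4)).add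
    ((isHomogeneous_X ℂ 1).mul (isHomogeneous_X ℂ 3))).add
    (((isHomogeneous_X ℂ 2).pow 2).C_mul _)

/-! ### Matrix entries of `so(7)` and brackets with the opposite nilradical. -/

/-- The row and column of `so(7)` that corresponds to a coordinate of the opposite nilradical. -/
def idx (i : Fin 5) : Fin 7 := i.succ.castSucc

/-- The entries of an element of `so(7)`. -/
abbrev entry (A : So7) (i j : Fin 7) : ℂ := (A : Matrix (Fin 7) (Fin 7) ℂ) i j

/-- The form pairs each index with its reverse, so skew-adjointness is antisymmetry about the
antidiagonal. Antidiagonal entries therefore vanish. -/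
theorem entry_rev (A : So7) (i j : Fin 7) : entry A j.rev i.rev = -entry A i j := by
  have h := A.2
  rw [mem_skewAdjointMatricesLieSubalgebra, mem_skewAdjointMatricesSubmodule,
    Matrix.IsSkewAdjoint, Matrix.IsAdjointPair] at h
  have h' := congrFun (congrFun h j) i.rev
  have hf : ∀ a b : Fin 7, formMatrix a b = if b = a.rev then 1 else 0 := fun _ _ => rfl
  have hf' : ∀ a b : Fin 7, formMatrix a b = if a = b.rev then 1 else 0 := by
    intro a b
    rw [hf]
    congr 1
    exact propext ⟨fun h => by rw [h, Fin.rev_rev], fun h => by rw [h, Fin.rev_rev]⟩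
  simp only [Matrix.mul_apply, Matrix.transpose_apply, Matrix.neg_apply, hf j, hf' _ i.rev,
    mul_ite, ite_mul, mul_one, one_mul, mul_zero, zero_mul, Finset.sum_ite_eq', Finset.mem_univ,
    if_true, Fin.rev_rev] at h'
  linear_combination h'

theorem idx_rev (i : Fin 5) : idx i.rev = (idx i).rev := by
  fin_cases i <;> rfl

theorem entry_zero_six (A : So7) : entry A 0 6 = 0 := by
  have h := entry_rev A 0 6
  change entry A 0 6 = _ at h
  linear_combination h / 2

theorem entry_six_zero (A : So7) : entry A 6 0 = 0 := by
  have h := entry_rev A 6 0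
  change entry A 6 0 = _ at h
  linear_combination h / 2

theorem entry_idx_six (A : So7) (i : Fin 5) : entry A (idx i) 6 = -entry A 0 (idx i.rev) := by
  rw [idx_rev, ← entry_rev, Fin.rev_rev]; rfl

theorem entry_lie (A B : So7) (i j : Fin 7) :
    entry ⁅A, B⁆ i j = ∑ k, entry A i k * entry B k j - ∑ k, entry B i k * entry A k j := rfl

theorem sum_fin_seven (f : Fin 7 → ℂ) : ∑ k, f k = f 0 + ∑ k, f (idx k) + f 6 := by
  rw [Fin.sum_univ_castSucc, Fin.sum_univ_succ]; rfl

theorem idx_injective : Function.Injective idx := fun _ _ h => by simpa [idx] using h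

theorem idx_ne_zero (i : Fin 5) : idx i ≠ 0 := by fin_cases i <;> decide

theorem idx_ne_six (i : Fin 5) : idx i ≠ 6 := by fin_cases i <;> decide

theorem entry_F (i j a b : Fin 7) : entry (F i j) a b =
    (if i = a ∧ j = b then 1 else 0) - (if j.rev = a ∧ i.rev = b then 1 else 0) := by
  change (Matrix.single i j 1 - Matrix.single j.rev i.rev 1 : Matrix (Fin 7) (Fin 7) ℂ) a b = _
  rw [Matrix.sub_apply, Matrix.single_apply, Matrix.single_apply]

/-- The basis of the opposite nilradical. -/
def lowering (i : Fin 5) : So7 := F (idx i) 0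

theorem entry_lowering (i : Fin 5) (a b : Fin 7) : entry (lowering i) a b =
    (if a = idx i then (if b = 0 then 1 else 0) else 0)
      - (if a = 6 then (if b = idx i.rev then 1 else 0) else 0) := by
  rw [lowering, entry_F, idx_rev]
  simp only [ite_and, eq_comm]
  rfl

theorem entry_lie_lowering (A : So7) (i : Fin 5) (a b : Fin 7) :
    entry ⁅A, lowering i⁆ a b =
      (if b = 0 then entry A a (idx i) else 0) - (if b = idx i.rev then entry A a 6 else 0)
      - (if a = idx i then entry A 0 b else 0) + (if a = 6 then entry A (idx i.rev) b else 0) := by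
  rw [entry_lie]
  simp only [entry_lowering, mul_sub, sub_mul, mul_ite, ite_mul, mul_one, mul_zero, one_mul,
    zero_mul, Finset.sum_sub_distrib]
  have e1 : ∀ (p : Prop) [Decidable p] (f : Fin 7 → ℂ),
      (∑ x, if p then f x else 0) = if p then ∑ x, f x else 0 := by
    intro p _ f; split_ifs <;> simp
  simp only [e1, Finset.sum_ite_eq', Finset.mem_univ, if_true]
  ring

theorem entry_lie_lowering_idx_zero (A : So7) (i j : Fin 5) :
    entry ⁅A, lowering i⁆ (idx j) 0 =
      entry A (idx j) (idx i) - if j = i then entry A 0 0 else 0 := by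
  rw [entry_lie_lowering]
  simp [idx_injective.eq_iff, (idx_ne_zero _).symm, idx_ne_six]

theorem entry_lie_lowering_zero_zero (A : So7) (i : Fin 5) :
    entry ⁅A, lowering i⁆ 0 0 = entry A 0 (idx i) := by
  rw [entry_lie_lowering]
  simp [(idx_ne_zero _).symm]

/-- Bracketing with `𝔫₋` lowers the grading by one, so no nilradical component survives and
second-order terms disappear. -/
theorem entry_lie_lowering_zero_idx (A : So7) (i j : Fin 5) :
    entry ⁅A, lowering i⁆ 0 (idx j) = 0 := by
  rw [entry_lie_lowering, entry_zero_six]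
  simp [(idx_ne_zero _).symm, idx_ne_zero]

theorem entry_lie_lowering_idx_idx (A : So7) (i j k : Fin 5) :
    entry ⁅A, lowering i⁆ (idx j) (idx k) =
      (if k = i.rev then entry A 0 (idx j.rev) else 0) - if j = i then entry A 0 (idx k) else 0 := by
  rw [entry_lie_lowering, entry_idx_six]
  simp [idx_injective.eq_iff, idx_ne_zero, idx_ne_six]
  split_ifs <;> simp

/-! ### The representation of `so(7)` on polynomials. -/

/-- The derivation by which the Levi component of an element of `so(7)` acts. -/
def leviDer (A : So7) : Derivation ℂ Poly5 Poly5 :=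
  mkDerivation ℂ fun i => ∑ j, C (entry A (idx j) (idx i)) * X j - C (entry A 0 0) * X i

theorem leviDer_X (A : So7) (i : Fin 5) :
    leviDer A (X i) = ∑ j, C (entry A (idx j) (idx i)) * X j - C (entry A 0 0) * X i :=
  mkDerivation_X _ _ _

/-- The value of an element of `so(7)` on the highest weight vector. -/
def vacuum (lam : ℂ) (A : So7) : Poly5 :=
  ∑ i, C (entry A (idx i) 0) * X i + C (lam * entry A 0 0)

/-- The action of an element of `so(7)` on polynomials. -/
def actFun (lam : ℂ) (A : So7) (f : Poly5) : Poly5 :=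
  vacuum lam A * f + leviDer A f + ∑ i, C (entry A 0 (idx i)) * conformalOp lam i f

theorem derivation_sum_apply {ι : Type*} (s : Finset ι) (D : ι → Derivation ℂ Poly5 Poly5)
    (f : Poly5) : (∑ k ∈ s, D k) f = ∑ k ∈ s, D k f := by
  classical
  induction s using Finset.induction_on with
  | empty => simp
  | insert a s ha h => rw [Finset.sum_insert ha, Finset.sum_insert ha, Derivation.add_apply, h]

/-- Only the nilradical component of `A` contributes: its bracket with `𝔫₋` lies in the Levi factor,
while the other components land in `𝔫₋`. -/
theorem leviDer_lie_lowering (A : So7) (i : Fin 5) (f : Poly5) :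
    leviDer ⁅A, lowering i⁆ f = - (C (entry A 0 (idx i)) * euler f)
      - X i * ∑ k, C (entry A 0 (idx k)) * pderiv k f
      + (∑ k, C (entry A 0 (idx k)) * X k.rev) * pderiv i.rev f := by
  have h : leviDer ⁅A, lowering i⁆ = - ((C (entry A 0 (idx i)) : Poly5) • euler)
      - (X i : Poly5) • ∑ k, (C (entry A 0 (idx k)) : Poly5) • (pderiv k : Derivation ℂ Poly5 Poly5)
      + (∑ k, C (entry A 0 (idx k)) * X k.rev : Poly5) • pderiv i.rev := by
    refine derivation_ext fun m => ?_
    -- Bracket entries carry the reversed index, so the sum is reindexed to match.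
    have hs : (∑ k, C (entry A 0 (idx k)) * X k.rev : Poly5)
        = ∑ k, C (entry A 0 (idx k.rev)) * X k := by
      refine Fintype.sum_equiv Fin.revPerm _ _ fun k => ?_
      simp
    rw [leviDer_X, entry_lie_lowering_zero_zero, hs]
    simp only [entry_lie_lowering_idx_idx, Derivation.add_apply, Derivation.sub_apply,
      Derivation.neg_apply, Derivation.smul_apply, smul_eq_mul, euler_X,
      C_sub, sub_mul, Finset.sum_sub_distrib, pderiv_X, apply_ite C, ite_mul, C_0, zero_mul,
      Finset.sum_ite_eq', Finset.mem_univ, if_true]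
    rw [derivation_sum_apply]
    simp only [Derivation.smul_apply, pderiv_X, smul_eq_mul, Pi.single_apply, mul_ite, mul_one,
      mul_zero, Finset.sum_ite_eq, Finset.mem_univ, if_true]
    split_ifs <;> ring
  rw [h]
  simp [derivation_sum_apply]

theorem vacuum_lie_lowering (lam : ℂ) (A : So7) (i : Fin 5) :
    vacuum lam ⁅A, lowering i⁆ = leviDer A (X i) + C (entry A 0 (idx i)) * C lam := by
  rw [vacuum, leviDer_X, entry_lie_lowering_zero_zero]
  simp only [entry_lie_lowering_idx_zero, C_sub, apply_ite C, C_0, sub_mul, ite_mul, zero_mul,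
    Finset.sum_sub_distrib, Finset.sum_ite_eq', Finset.mem_univ, if_true, C_mul]
  ring

/-- This is the relation `A Lᵢ = Lᵢ A + [A, Lᵢ]` with `Lᵢ` acting as `Xᵢ`. With the value at `1` it
determines the action. -/
theorem actFun_X_mul (lam : ℂ) (A : So7) (i : Fin 5) (f : Poly5) :
    actFun lam A (X i * f) = X i * actFun lam A f + actFun lam ⁅A, lowering i⁆ f := by
  have hs : ∑ k, C (entry A 0 (idx k)) * conformalOp lam k (X i * f) =
      X i * ∑ k, C (entry A 0 (idx k)) * conformalOp lam k f
        + C (entry A 0 (idx i)) * (C lam * f - euler f)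
        - X i * ∑ k, C (entry A 0 (idx k)) * pderiv k f
        + (∑ k, C (entry A 0 (idx k)) * X k.rev) * pderiv i.rev f := by
    have ht : ∀ k, C (entry A 0 (idx k)) * conformalOp lam k (X i * f) =
        X i * (C (entry A 0 (idx k)) * conformalOp lam k f)
          + (if i = k then C (entry A 0 (idx k)) * (C lam * f - euler f) else 0)
          - X i * (C (entry A 0 (idx k)) * pderiv k f)
          + (C (entry A 0 (idx k)) * X k.rev) * pderiv i.rev f := by
      intro k
      rw [conformalOp_X_mul]
      split_ifs <;> ring
    rw [Finset.sum_congr rfl fun k _ => ht k, Finset.sum_add_distrib, Finset.sum_sub_distrib,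
      Finset.sum_add_distrib, Finset.sum_ite_eq, if_pos (Finset.mem_univ _), Finset.mul_sum,
      Finset.mul_sum, Finset.sum_mul]
  rw [actFun, actFun, actFun, hs, leviDer_lie_lowering, vacuum_lie_lowering, Derivation.leibniz,
    smul_eq_mul, smul_eq_mul]
  simp only [entry_lie_lowering_zero_idx, C_0, zero_mul, Finset.sum_const_zero]
  ring

theorem actFun_one (lam : ℂ) (A : So7) : actFun lam A 1 = vacuum lam A := by
  simp [actFun, conformalOp_one]

theorem entry_add (A B : So7) (i j : Fin 7) : entry (A + B) i j = entry A i j + entry B i j := rfl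

theorem entry_smul (c : ℂ) (A : So7) (i j : Fin 7) : entry (c • A) i j = c * entry A i j := rfl

theorem leviDer_add (A B : So7) : leviDer (A + B) = leviDer A + leviDer B := by
  refine derivation_ext fun i => ?_
  simp only [leviDer_X, Derivation.add_apply, entry_add, C_add, add_mul, Finset.sum_add_distrib]
  ring

theorem leviDer_smul (c : ℂ) (A : So7) : leviDer (c • A) = c • leviDer A := by
  refine derivation_ext fun i => ?_
  simp only [leviDer_X, Derivation.smul_apply, entry_smul, C_mul, smul_eq_C_mul, mul_assoc,
    mul_sub, Finset.mul_sum]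

theorem actFun_add_left (lam : ℂ) (A B : So7) (f : Poly5) :
    actFun lam (A + B) f = actFun lam A f + actFun lam B f := by
  simp only [actFun, vacuum, entry_add, leviDer_add, Derivation.add_apply, C_add, add_mul, mul_add,
    Finset.sum_add_distrib]
  ring

theorem actFun_smul_left (lam c : ℂ) (A : So7) (f : Poly5) :
    actFun lam (c • A) f = c • actFun lam A f := by
  simp only [actFun, vacuum, entry_smul, leviDer_smul, Derivation.smul_apply, C_mul, smul_eq_C_mul,
    mul_add, add_mul, Finset.mul_sum, Finset.sum_mul, mul_assoc]
  congr 2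
  congr 1
  ring

/-- The action of an element of `so(7)` on polynomials, as a linear map. -/
def act (lam : ℂ) (A : So7) : Poly5 →ₗ[ℂ] Poly5 where
  toFun := actFun lam A
  map_add' f g := by
    simp only [actFun, map_add, mul_add, Finset.sum_add_distrib]; ring
  map_smul' c f := by
    simp only [actFun, smul_eq_C_mul, RingHom.id_apply]
    simp only [← smul_eq_C_mul, map_smul, Derivation.map_smul, smul_add, mul_smul_comm,
      Finset.smul_sum]

theorem act_X_mul (lam : ℂ) (A : So7) (i : Fin 5) (f : Poly5) :
    act lam A (X i * f) = X i * act lam A f + act lam ⁅A, lowering i⁆ f :=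
  actFun_X_mul lam A i f

theorem act_one (lam : ℂ) (A : So7) : act lam A 1 = vacuum lam A := actFun_one lam A

theorem act_add (lam : ℂ) (A B : So7) : act lam (A + B) = act lam A + act lam B :=
  LinearMap.ext fun f => actFun_add_left lam A B f

theorem act_smul (lam c : ℂ) (A : So7) : act lam (c • A) = c • act lam A :=
  LinearMap.ext fun f => actFun_smul_left lam c A f

theorem act_sub (lam : ℂ) (A B : So7) : act lam (A - B) = act lam A - act lam B := by
  rw [eq_sub_iff_add_eq, ← act_add, sub_add_cancel]

theorem act_vacuum (lam : ℂ) (A B : So7) : act lam A (vacuum lam B) =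
    vacuum lam B * vacuum lam A + ∑ i, C (entry B (idx i) 0) * vacuum lam ⁅A, lowering i⁆ := by
  have h : ∀ i, act lam A (C (entry B (idx i) 0) * X i) =
      C (entry B (idx i) 0) * X i * vacuum lam A
        + C (entry B (idx i) 0) * vacuum lam ⁅A, lowering i⁆ := by
    intro i
    rw [C_mul', map_smul, ← mul_one (X i), act_X_mul, act_one, act_one, smul_add, mul_one,
      C_mul', smul_mul_assoc]
  have h0 : act lam A (C (lam * entry B 0 0)) = C (lam * entry B 0 0) * vacuum lam A := by
    rw [← mul_one (C _), C_mul', map_smul, act_one, smul_mul_assoc, one_mul]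
  conv_lhs => rw [vacuum]
  rw [map_add, map_sum, Finset.sum_congr rfl fun i _ => h i, h0, Finset.sum_add_distrib,
    ← Finset.sum_mul]
  conv_rhs => rw [vacuum]
  ring

/-- The base case of `act_lie`: the symmetric product of the two vacuum values in `act_vacuum`
cancels, leaving this identity between degree-one polynomials. -/
theorem vacuum_lie (lam : ℂ) (A B : So7) : vacuum lam ⁅A, B⁆ =
    ∑ i, C (entry B (idx i) 0) * vacuum lam ⁅A, lowering i⁆
      - ∑ i, C (entry A (idx i) 0) * vacuum lam ⁅B, lowering i⁆ := by
  have h : ∀ A B : So7, ∑ i, C (entry B (idx i) 0) * vacuum lam ⁅A, lowering i⁆ =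
      ∑ j, C (∑ i, entry A (idx j) (idx i) * entry B (idx i) 0) * X j
        - C (entry A 0 0) * ∑ j, C (entry B (idx j) 0) * X j
        + C (lam * ∑ i, entry A 0 (idx i) * entry B (idx i) 0) := by
    intro A B
    have ht : ∀ i, C (entry B (idx i) 0) * vacuum lam ⁅A, lowering i⁆ =
        ∑ j, C (entry A (idx j) (idx i) * entry B (idx i) 0) * X j
          - C (entry A 0 0) * (C (entry B (idx i) 0) * X i)
          + C (lam * (entry A 0 (idx i) * entry B (idx i) 0)) := by
      intro i
      have hj : ∀ j, C (entry A (idx j) (idx i) * entry B (idx i) 0) * (X j : Poly5) =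
          C (entry B (idx i) 0) * (C (entry A (idx j) (idx i)) * X j) := fun j => by
        rw [C_mul]; ring
      rw [vacuum_lie_lowering, leviDer_X, Finset.sum_congr rfl fun j _ => hj j, ← Finset.mul_sum,
        C_mul, C_mul]
      ring
    rw [Finset.sum_congr rfl fun i _ => ht i, Finset.sum_add_distrib, Finset.sum_sub_distrib,
      Finset.sum_comm, ← Finset.mul_sum, ← map_sum, ← Finset.mul_sum]
    congr 2
    exact Finset.sum_congr rfl fun j _ => by rw [map_sum, Finset.sum_mul]
  have h1 : ∀ j, entry ⁅A, B⁆ (idx j) 0 =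
      (∑ i, entry A (idx j) (idx i) * entry B (idx i) 0 - entry A 0 0 * entry B (idx j) 0)
        - (∑ i, entry B (idx j) (idx i) * entry A (idx i) 0 - entry B 0 0 * entry A (idx j) 0) := by
    intro j
    rw [entry_lie, sum_fin_seven, sum_fin_seven, entry_six_zero, entry_six_zero]
    ring
  have h2 : entry ⁅A, B⁆ 0 0 = ∑ i, entry A 0 (idx i) * entry B (idx i) 0
      - ∑ i, entry B 0 (idx i) * entry A (idx i) 0 := by
    rw [entry_lie, sum_fin_seven, sum_fin_seven, entry_six_zero, entry_six_zero]
    ring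
  have h3 : ∑ j, C (entry ⁅A, B⁆ (idx j) 0) * (X j : Poly5) =
      (∑ j, C (∑ i, entry A (idx j) (idx i) * entry B (idx i) 0) * X j
        - C (entry A 0 0) * ∑ j, C (entry B (idx j) 0) * X j)
      - (∑ j, C (∑ i, entry B (idx j) (idx i) * entry A (idx i) 0) * X j
        - C (entry B 0 0) * ∑ j, C (entry A (idx j) 0) * X j) := by
    rw [Finset.mul_sum, Finset.mul_sum, ← Finset.sum_sub_distrib, ← Finset.sum_sub_distrib,
      ← Finset.sum_sub_distrib]
    refine Finset.sum_congr rfl fun j _ => ?_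
    rw [h1, C_sub, C_sub, C_sub, C_mul, C_mul]
    ring
  rw [h, h, vacuum, h3, h2, mul_sub, C_sub]
  ring

theorem act_lie_one (lam : ℂ) (A B : So7) :
    act lam ⁅A, B⁆ 1 = act lam A (act lam B 1) - act lam B (act lam A 1) := by
  rw [act_one, act_one, act_one, act_vacuum, act_vacuum, vacuum_lie]
  ring

/-- Induction on the degree: the step is the Jacobi identity for `A`, `B` and `lowering i`. The
hypothesis is also applied to brackets with `lowering i`, hence the induction over all `A`, `B`. -/
theorem act_lie (lam : ℂ) (A B : So7) (f : Poly5) :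
    act lam ⁅A, B⁆ f = act lam A (act lam B f) - act lam B (act lam A f) := by
  induction f using MvPolynomial.induction_on generalizing A B with
  | C a =>
    rw [← mul_one (C a), C_mul']
    simp only [map_smul, act_lie_one, smul_sub]
  | add p q hp hq =>
    simp only [map_add, hp, hq]; ring
  | mul_X p i hp =>
    rw [mul_comm]
    simp only [act_X_mul, map_add]
    rw [lie_lie, act_sub, LinearMap.sub_apply, hp A B, hp A ⁅B, lowering i⁆, hp B ⁅A, lowering i⁆]
    ring

/-- The representation of `so(7)` on polynomials. -/
def rep (lam : ℂ) : So7 →ₗ⁅ℂ⁆ Module.End ℂ Poly5 where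
  toFun := act lam
  map_add' := act_add lam
  map_smul' c A := act_smul lam c A
  map_lie' {A B} := LinearMap.ext fun f => act_lie lam A B f

/-! ### The decomposition of `so(7)` into `𝔫₋` and `𝔭`. -/

theorem so7_ext {A B : So7} (h : ∀ i j, entry A i j = entry B i j) : A = B :=
  Subtype.ext (Matrix.ext h)

theorem eq_zero_or_idx_or_six (a : Fin 7) : a = 0 ∨ (∃ i, a = idx i) ∨ a = 6 := by
  fin_cases a
  · exact Or.inl rfl
  · exact Or.inr (Or.inl ⟨0, rfl⟩)
  · exact Or.inr (Or.inl ⟨1, rfl⟩)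
  · exact Or.inr (Or.inl ⟨2, rfl⟩)
  · exact Or.inr (Or.inl ⟨3, rfl⟩)
  · exact Or.inr (Or.inl ⟨4, rfl⟩)
  · exact Or.inr (Or.inr rfl)

theorem entry_sum {ι : Type*} (s : Finset ι) (A : ι → So7) (a b : Fin 7) :
    entry (∑ i ∈ s, A i) a b = ∑ i ∈ s, entry (A i) a b := by
  classical
  induction s using Finset.induction_on with
  | empty => rfl
  | insert i s hi h => rw [Finset.sum_insert hi, Finset.sum_insert hi, entry_add, h]

/-- The component of an element of `so(7)` in the opposite nilradical. -/
def lowPart (A : So7) : So7 := ∑ i, entry A (idx i) 0 • lowering i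

theorem entry_lowPart (A : So7) (a b : Fin 7) : entry (lowPart A) a b =
    ∑ i, entry A (idx i) 0 * entry (lowering i) a b := by
  rw [lowPart, entry_sum]; rfl

theorem entry_lowPart_idx_zero (A : So7) (j : Fin 5) :
    entry (lowPart A) (idx j) 0 = entry A (idx j) 0 := by
  rw [entry_lowPart]
  simp [entry_lowering, idx_injective.eq_iff, idx_ne_six]

theorem entry_lowPart_zero (A : So7) (b : Fin 7) : entry (lowPart A) 0 b = 0 := by
  rw [entry_lowPart]
  simp [entry_lowering, (idx_ne_zero _).symm]

theorem entry_lowPart_idx_of_ne (A : So7) (j : Fin 5) {b : Fin 7} (hb : b ≠ 0) :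
    entry (lowPart A) (idx j) b = 0 := by
  rw [entry_lowPart]
  simp [entry_lowering, hb, idx_ne_six]

theorem sub_lowPart_mem (A : So7) : A - lowPart A ∈ conformalParabolic := by
  intro i hi
  change entry A i 0 - entry (lowPart A) i 0 = 0
  rcases eq_zero_or_idx_or_six i with rfl | ⟨j, rfl⟩ | rfl
  · exact absurd rfl hi
  · rw [entry_lowPart_idx_zero, sub_self]
  · rw [entry_six_zero, entry_six_zero, sub_self]

theorem entry_lie_grading (A : So7) (a b : Fin 7) : entry ⁅gradingSo7, A⁆ a b =
    ((if a = 0 then 1 else 0) - (if a = 6 then 1 else 0)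
      - ((if b = 0 then 1 else 0) - (if b = 6 then 1 else 0))) * entry A a b := by
  have h : ∀ a b, entry gradingSo7 a b =
      (if a = b then (if a = 0 then 1 else 0) - (if a = 6 then 1 else 0) else 0 : ℂ) := by
    intro a b
    rw [gradingSo7, entry_F]
    change (if 0 = a ∧ 0 = b then 1 else 0) - (if (6 : Fin 7) = a ∧ (6 : Fin 7) = b then 1 else 0) = _
    rcases eq_or_ne a b with rfl | h
    · simp [eq_comm]
    · rw [if_neg (fun h' => h (h'.1.symm.trans h'.2)), if_neg (fun h' => h (h'.1.symm.trans h'.2)),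
        if_neg h, sub_self]
  rw [entry_lie]
  simp only [h, ite_mul, mul_ite, mul_zero, zero_mul, Finset.sum_ite_eq, Finset.sum_ite_eq',
    Finset.mem_univ, if_true]
  ring

/-- Entries are eigenvectors of the grading element, so those of grading weight other than `-1`
vanish. -/
theorem lowPart_eq_self {A : So7} (hA : A ∈ nMinus) : lowPart A = A := by
  have h : ∀ a b, ((if a = 0 then 1 else 0) - (if a = 6 then 1 else 0)
      - ((if b = 0 then 1 else 0) - (if b = 6 then 1 else 0))) * entry A a b = - entry A a b := by
    intro a b
    rw [← entry_lie_grading]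
    exact congrArg (fun B => entry B a b) (show ⁅gradingSo7, A⁆ = -A from hA)
  have h0 : ∀ b, entry A 0 b = 0 := by
    intro b
    rcases eq_zero_or_idx_or_six b with rfl | ⟨j, rfl⟩ | rfl
    · have := h 0 0
      simpa using this
    · have := h 0 (idx j)
      simp only [if_true, idx_ne_zero, idx_ne_six, if_false, Fin.reduceEq] at this
      linear_combination this / 2
    · exact entry_zero_six A
  have hj : ∀ j b, b ≠ 0 → entry A (idx j) b = 0 := by
    intro j b hb
    rcases eq_zero_or_idx_or_six b with rfl | ⟨k, rfl⟩ | rfl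
    · exact absurd rfl hb
    · have := h (idx j) (idx k)
      simp only [idx_ne_zero, idx_ne_six, if_false] at this
      linear_combination this
    · rw [entry_idx_six, h0, neg_zero]
  refine so7_ext fun a b => ?_
  have hrow : ∀ j b, entry (lowPart A) (idx j) b = entry A (idx j) b := by
    intro j b
    by_cases hb : b = 0
    · rw [hb, entry_lowPart_idx_zero]
    · rw [entry_lowPart_idx_of_ne A j hb, hj j b hb]
  rcases eq_zero_or_idx_or_six a with rfl | ⟨j, rfl⟩ | rfl
  · rw [entry_lowPart_zero, h0]
  · exact hrow j b
  · rcases eq_zero_or_idx_or_six b with rfl | ⟨k, rfl⟩ | rfl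
    · rw [entry_six_zero, entry_six_zero]
    · have e : ∀ B : So7, entry B 6 (idx k) = - entry B (idx k.rev) 0 := by
        intro B
        rw [idx_rev, ← entry_rev, Fin.rev_rev]; rfl
      rw [e, e, hrow]
    · have e : ∀ B : So7, entry B 6 6 = - entry B 0 0 := fun B => by rw [← entry_rev]; rfl
      rw [e, e, entry_lowPart_zero, h0]

theorem lowering_mem_nMinus (i : Fin 5) : lowering i ∈ nMinus := by
  change ⁅gradingSo7, lowering i⁆ = -lowering i
  refine so7_ext fun a b => ?_
  rw [entry_lie_grading]
  change _ = - entry (lowering i) a b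
  rw [entry_lowering]
  rcases eq_zero_or_idx_or_six a with rfl | ⟨j, rfl⟩ | rfl <;>
  rcases eq_zero_or_idx_or_six b with rfl | ⟨k, rfl⟩ | rfl <;>
  simp [idx_ne_zero, idx_ne_six, (idx_ne_zero _).symm, (idx_ne_six _).symm] <;>
  split_ifs <;> simp

/-! ### Identification of the generalized Verma module with polynomials. -/

theorem lie_lowering_lowering (i j : Fin 5) : ⁅lowering i, lowering j⁆ = 0 := by
  refine so7_ext fun a b => ?_
  change _ = (0 : ℂ)
  rw [entry_lie_lowering]
  have h : (j.rev = i) = (j = i.rev) :=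
    propext ⟨fun h => by rw [← h, Fin.rev_rev], fun h => by rw [h, Fin.rev_rev]⟩
  simp only [entry_lowering, idx_injective.eq_iff, idx_ne_zero, idx_ne_six, (idx_ne_zero _).symm,
    (idx_ne_six _).symm, if_false, h, Fin.reduceEq]
  split_ifs <;> simp

theorem lowering_commute (i j : Fin 5) :
    toU (lowering i) * toU (lowering j) = toU (lowering j) * toU (lowering i) := by
  have h := LieHom.map_lie toU (lowering i) (lowering j)
  rw [lie_lowering_lowering, map_zero, LieRing.of_associative_ring_bracket] at h
  exact (sub_eq_zero.1 h.symm)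

open scoped IsMulCommutative in
/-- The inclusion of the symmetric algebra of the opposite nilradical in `U(so(7))`. -/
def polyToU : Poly5 →ₐ[ℂ] U :=
  haveI : IsMulCommutative (Algebra.adjoin ℂ (Set.range fun i => toU (lowering i))) :=
    Algebra.isMulCommutative_adjoin ℂ (by
      rintro _ ⟨i, rfl⟩ _ ⟨j, rfl⟩
      exact lowering_commute i j)
  (Algebra.adjoin ℂ (Set.range fun i => toU (lowering i))).val.comp
    (aeval (R := ℂ) (S₁ := Algebra.adjoin ℂ (Set.range fun i => toU (lowering i)))
      fun i => ⟨toU (lowering i), Algebra.subset_adjoin ⟨i, rfl⟩⟩)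

theorem polyToU_X (i : Fin 5) : polyToU (X i) = toU (lowering i) := by
  simp [polyToU]

theorem polyToU_C (a : ℂ) : polyToU (C a) = algebraMap ℂ U a := by
  rw [← algebraMap_eq, AlgHom.commutes]

/-- The action of `U(so(7))` on polynomials. -/
def repU (lam : ℂ) : U →ₐ[ℂ] Module.End ℂ Poly5 := UniversalEnvelopingAlgebra.lift ℂ (rep lam)

theorem repU_toU (lam : ℂ) (A : So7) (f : Poly5) : repU lam (toU A) f = act lam A f := by
  rw [repU, UniversalEnvelopingAlgebra.lift_ι_apply]; rfl

theorem act_lowering (lam : ℂ) (i : Fin 5) (f : Poly5) : act lam (lowering i) f = X i * f := by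
  have h0 : ∀ b, entry (lowering i) 0 b = 0 := by
    intro b
    simp [entry_lowering, (idx_ne_zero _).symm]
  have h1 : leviDer (lowering i) = 0 := by
    refine derivation_ext fun k => ?_
    rw [leviDer_X, h0]
    simp [entry_lowering, idx_ne_zero, idx_ne_six]
  have h2 : vacuum lam (lowering i) = X i := by
    rw [vacuum, h0]
    simp [entry_lowering, idx_ne_six, idx_injective.eq_iff]
  change actFun lam (lowering i) f = _
  rw [actFun, h1, h2]
  simp [h0]

theorem repU_polyToU (lam : ℂ) (f g : Poly5) : repU lam (polyToU f) g = f * g := by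
  induction f using MvPolynomial.induction_on generalizing g with
  | C a => rw [polyToU_C, AlgHom.commutes, C_mul']; rfl
  | add p q hp hq => rw [map_add, map_add, LinearMap.add_apply, hp, hq, add_mul]
  | mul_X p i hp =>
    rw [map_mul, map_mul, Module.End.mul_apply, polyToU_X, repU_toU, act_lowering, hp, mul_assoc]

theorem vacuum_of_mem (lam : ℂ) {A : So7} (hA : A ∈ conformalParabolic) :
    vacuum lam A = C (lam * entry A 0 0) := by
  rw [vacuum, Finset.sum_eq_zero fun i _ => ?_, zero_add]
  rw [show entry A (idx i) 0 = 0 from hA _ (idx_ne_zero i), C_0, zero_mul]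

/-- The value of an element of `U(so(7))` on the highest weight vector of the polynomial model. -/
def evalVacuum (lam : ℂ) : U →ₗ[ℂ] Poly5 :=
  (LinearMap.applyₗ (R := ℂ) (1 : Poly5) : Module.End ℂ Poly5 →ₗ[ℂ] Poly5) ∘ₗ
    (repU lam).toLinearMap

/-- The polynomial `1` transforms under `𝔭` by the inducing character, so evaluation at `1` descends
to the quotient. -/
theorem vermaIdeal_le_ker (lam : ℂ) :
    (vermaIdeal lam).restrictScalars ℂ ≤ LinearMap.ker (evalVacuum lam) := by
  intro w hw
  change repU lam w 1 = 0
  change w ∈ vermaIdeal lam at hw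
  induction hw using Submodule.span_induction with
  | mem x h =>
    obtain ⟨A, rfl⟩ := h
    change repU lam (toU (A : So7) - algebraMap ℂ U (parabolicCharacter lam A)) 1 = 0
    rw [map_sub, AlgHom.commutes, LinearMap.sub_apply, repU_toU, act_one, vacuum_of_mem lam A.2,
      Module.algebraMap_end_apply, smul_eq_C_mul, mul_one, sub_eq_zero]
    rfl
  | zero => simp
  | add x y _ _ hx hy => rw [map_add, LinearMap.add_apply, hx, hy, add_zero]
  | smul a x _ hx => rw [smul_eq_mul, map_mul, Module.End.mul_apply, hx, map_zero]

/-- The isomorphism of the generalized Verma module with its polynomial model. -/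
def toPoly (lam : ℂ) : Verma lam →ₗ[ℂ] Poly5 :=
  (((vermaIdeal lam).restrictScalars ℂ).liftQ (evalVacuum lam) (vermaIdeal_le_ker lam)) ∘ₗ
    (Submodule.Quotient.restrictScalarsEquiv ℂ (vermaIdeal lam)).symm.toLinearMap

theorem toPoly_smul_hwv (lam : ℂ) (w : U) : toPoly lam (w • hwv lam) = repU lam w 1 := by
  rw [hwv, ← Submodule.Quotient.mk_smul, smul_eq_mul, mul_one]
  rfl

theorem exists_smul_hwv {lam : ℂ} (v : Verma lam) : ∃ w : U, v = w • hwv lam := by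
  obtain ⟨w, rfl⟩ := Submodule.Quotient.mk_surjective _ v
  exact ⟨w, by rw [hwv, ← Submodule.Quotient.mk_smul, smul_eq_mul, mul_one]⟩

theorem toPoly_smul (lam : ℂ) (w : U) (v : Verma lam) :
    toPoly lam (w • v) = repU lam w (toPoly lam v) := by
  obtain ⟨w', rfl⟩ := exists_smul_hwv v
  rw [smul_smul, toPoly_smul_hwv, toPoly_smul_hwv, map_mul, Module.End.mul_apply]

theorem toPoly_polyToU (lam : ℂ) (f : Poly5) : toPoly lam (polyToU f • hwv lam) = f := by
  rw [toPoly_smul_hwv, repU_polyToU, mul_one]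

theorem toPoly_hwv (lam : ℂ) : toPoly lam (hwv lam) = 1 := by
  have := toPoly_polyToU lam 1
  rwa [map_one, one_smul] at this

theorem parabolic_smul_hwv (lam : ℂ) {A : So7} (hA : A ∈ conformalParabolic) :
    toU A • hwv lam = algebraMap ℂ U (lam * entry A 0 0) • hwv lam := by
  have h : (toU A - algebraMap ℂ U (lam * entry A 0 0)) ∈ vermaIdeal lam :=
    Submodule.subset_span ⟨⟨A, hA⟩, rfl⟩
  have h' : (toU A - algebraMap ℂ U (lam * entry A 0 0)) • hwv lam = 0 := by
    rw [hwv, ← Submodule.Quotient.mk_smul, smul_eq_mul, mul_one]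
    exact (Submodule.Quotient.mk_eq_zero _).2 h
  rwa [sub_smul, sub_eq_zero] at h'

theorem toU_smul_hwv (lam : ℂ) (A : So7) : toU A • hwv lam = polyToU (vacuum lam A) • hwv lam := by
  have h := parabolic_smul_hwv lam (sub_lowPart_mem A)
  have h0 : entry (A - lowPart A) 0 0 = entry A 0 0 := by
    change entry A 0 0 - entry (lowPart A) 0 0 = _
    rw [entry_lowPart_zero, sub_zero]
  have h1 : toU (lowPart A) = polyToU (∑ i, C (entry A (idx i) 0) * X i) := by
    rw [lowPart, map_sum, map_sum]
    refine Finset.sum_congr rfl fun i _ => ?_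
    rw [map_smul, C_mul', map_smul, polyToU_X]
  rw [map_sub, sub_smul, sub_eq_iff_eq_add, h0] at h
  rw [h, vacuum, map_add, polyToU_C, add_smul, h1, add_comm]

/-- The Verma module obeys the same recursion and initial value as the model, so the actions agree
by induction. -/
theorem toU_smul_polyToU (lam : ℂ) (A : So7) (f : Poly5) :
    toU A • polyToU f • hwv lam = polyToU (act lam A f) • hwv lam := by
  induction f using MvPolynomial.induction_on generalizing A with
  | C a =>
    rw [← mul_one (C a), C_mul', map_smul, map_smul, map_smul, map_one, act_one, smul_assoc,
      one_smul, smul_comm, toU_smul_hwv, smul_assoc]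
  | add p q hp hq => rw [map_add, map_add, map_add, add_smul, add_smul, smul_add, hp, hq]
  | mul_X p i hp =>
    have h := LieHom.map_lie toU A (lowering i)
    rw [LieRing.of_associative_ring_bracket] at h
    rw [mul_comm, act_X_mul, map_mul, map_add, map_mul, add_smul, polyToU_X, mul_smul, mul_smul,
      ← hp, ← hp, h, sub_smul, mul_smul, mul_smul]
    abel

/-- By the universal property the identity of `U` factors through the subalgebra generated by
`so(7)`. -/
theorem adjoin_range_toU : Algebra.adjoin ℂ (Set.range toU) = ⊤ := by
  let S := Algebra.adjoin ℂ (Set.range toU)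
  let φ : So7 →ₗ⁅ℂ⁆ S :=
    { toFun := fun A => ⟨toU A, Algebra.subset_adjoin ⟨A, rfl⟩⟩
      map_add' := fun A B => Subtype.ext (map_add toU A B)
      map_smul' := fun c A => Subtype.ext (map_smul toU c A)
      map_lie' := fun {A B} => Subtype.ext (LieHom.map_lie toU A B) }
  have h : S.val.comp (UniversalEnvelopingAlgebra.lift ℂ φ) = AlgHom.id ℂ U := by
    refine UniversalEnvelopingAlgebra.hom_ext ℂ (LieHom.ext fun A => ?_)
    change S.val (UniversalEnvelopingAlgebra.lift ℂ φ (toU A)) = toU A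
    rw [UniversalEnvelopingAlgebra.lift_ι_apply]
    rfl
  rw [eq_top_iff]
  intro w _
  have := congrArg (fun ψ : U →ₐ[ℂ] U => ψ w) h
  change ((UniversalEnvelopingAlgebra.lift ℂ φ w : S) : U) = w at this
  rw [← this]
  exact Subtype.mem _

theorem smul_polyToU (lam : ℂ) (w : U) (f : Poly5) :
    w • polyToU f • hwv lam = polyToU (repU lam w f) • hwv lam := by
  have hw : w ∈ Algebra.adjoin ℂ (Set.range toU) := by rw [adjoin_range_toU]; trivial
  induction hw using Algebra.adjoin_induction generalizing f with
  | mem x h =>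
    obtain ⟨A, rfl⟩ := h
    rw [toU_smul_polyToU, repU_toU]
  | algebraMap r =>
    rw [AlgHom.commutes, Module.algebraMap_end_apply, map_smul, algebraMap_smul, smul_assoc]
  | add x y _ _ hx hy => rw [add_smul, hx, hy, map_add, LinearMap.add_apply, map_add, add_smul]
  | mul x y _ _ hx hy => rw [mul_smul, hy, hx, map_mul, Module.End.mul_apply]

/-- With `toPoly_polyToU` this makes `toPoly` bijective; the explicit model takes the place of the
PBW theorem. -/
theorem polyToU_toPoly {lam : ℂ} (v : Verma lam) : polyToU (toPoly lam v) • hwv lam = v := by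
  obtain ⟨w, rfl⟩ := exists_smul_hwv v
  rw [toPoly_smul_hwv, ← smul_polyToU, map_one, one_smul]

theorem toPoly_injective (lam : ℂ) : Function.Injective (toPoly lam) := fun v w h => by
  rw [← polyToU_toPoly v, h, polyToU_toPoly]

theorem hwv_ne_zero (lam : ℂ) : hwv lam ≠ 0 := by
  intro h
  have := toPoly_hwv lam
  rw [h, map_zero] at this
  exact zero_ne_one this

theorem map_nMinus : Submodule.map (toU : So7 →ₗ[ℂ] U) nMinus
    = Submodule.map polyToU.toLinearMap (homogeneousSubmodule (Fin 5) ℂ 1) := by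
  rw [homogeneousSubmodule_one_eq_span_X, Submodule.map_span, ← Set.range_comp]
  apply le_antisymm
  · rintro _ ⟨A, hA, rfl⟩
    change toU A ∈ _
    rw [← lowPart_eq_self hA, lowPart, map_sum]
    refine Submodule.sum_mem _ fun i _ => ?_
    rw [map_smul]
    exact Submodule.smul_mem _ _ (Submodule.subset_span ⟨i, polyToU_X i⟩)
  · rw [Submodule.span_le]
    rintro _ ⟨i, rfl⟩
    exact ⟨lowering i, lowering_mem_nMinus i, (polyToU_X i).symm⟩

/-- `𝔫₋` is the image of the linear forms, and the `d`-th power of that space is the space of forms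
of degree `d`. -/
theorem mem_homogeneousPart_iff {lam : ℂ} {d : ℕ} {v : Verma lam} :
    v ∈ homogeneousPart lam d ↔ (toPoly lam v).IsHomogeneous d := by
  rw [homogeneousPart, map_nMinus, ← Submodule.map_pow, homogeneousSubmodule_one_pow]
  constructor
  · rintro ⟨_, ⟨f, hf, rfl⟩, rfl⟩
    change (toPoly lam (polyToU f • hwv lam)).IsHomogeneous d
    rw [toPoly_polyToU]
    exact hf
  · intro h
    exact ⟨_, ⟨toPoly lam v, h, rfl⟩, polyToU_toPoly v⟩

/-! ### Generators contained in the two singularity conditions. -/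

theorem lie_F (i j k l : Fin 7) : ⁅F i j, F k l⁆ =
    ((if j = k then 1 else 0 : ℂ) • F i l - (if l = i then 1 else 0 : ℂ) • F k j)
      - ((if j = l.rev then 1 else 0 : ℂ) • F i k.rev
        - (if k.rev = i then 1 else 0 : ℂ) • F l.rev j) := by
  refine so7_ext fun a b => ?_
  -- Writing all conditions as scalar Kronecker deltas reduces the bracket formula to a ring
  -- identity.
  let δ : Fin 7 → Fin 7 → ℂ := fun x y => if x = y then 1 else 0
  have hF : ∀ i j a b, entry (F i j) a b = δ i a * δ j b - δ j.rev a * δ i.rev b := by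
    intro i j a b
    rw [entry_F]
    simp only [δ, ite_and, mul_ite, mul_one, mul_zero]
    split_ifs <;> simp_all
  have hs : ∀ x y, ∑ z, δ x z * δ y z = δ x y := by
    intro x y
    simp [δ]
  have hc : ∀ x y, δ x y = δ y x := fun x y => by simp only [δ, eq_comm]
  have hr : ∀ x y : Fin 7, δ x.rev y = δ x y.rev := by
    intro x y
    have : (x.rev = y) = (x = y.rev) :=
      propext ⟨fun h => by rw [← h, Fin.rev_rev], fun h => by rw [h, Fin.rev_rev]⟩
    simp only [δ, this]
  have hm : ∀ i j k l a b, ∑ z, entry (F i j) a z * entry (F k l) z b =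
      δ i a * δ j k * δ l b - δ i a * δ j l.rev * δ k b.rev
        - δ j a.rev * δ i k.rev * δ l b + δ j a.rev * δ i l * δ k b.rev := by
    intro i j k l a b
    have : ∀ z, entry (F i j) a z * entry (F k l) z b =
        δ i a * δ l b * (δ j z * δ k z) - δ i a * δ k.rev b * (δ j z * δ l.rev z)
        - δ j.rev a * δ l b * (δ i.rev z * δ k z)
        + δ j.rev a * δ k.rev b * (δ i.rev z * δ l.rev z) := by
      intro z
      rw [hF, hF]; ring
    simp only [this, Finset.sum_add_distrib, Finset.sum_sub_distrib, ← Finset.mul_sum, hs]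
    simp only [hr, Fin.rev_rev]
    ring
  rw [entry_lie, hm, hm]
  change _ = (δ j k * entry (F i l) a b - δ l i * entry (F k j) a b)
    - (δ j l.rev * entry (F i k.rev) a b - δ k.rev i * entry (F l.rev j) a b)
  simp only [hF, hr, Fin.rev_rev]
  rw [hc l i, hc k i.rev, hc l j.rev, hc k j, hr, hr]
  ring

theorem F_mem {i j : Fin 7} (hj : j ≠ 0) (hi : i ≠ 6) : F i j ∈ conformalParabolic := by
  intro a _
  change entry (F i j) a 0 = 0
  have h : ¬ i.rev = 0 := fun h => hi (by rw [← Fin.rev_rev i, h]; rfl)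
  rw [entry_F, if_neg (fun h' => hj h'.2), if_neg (fun h' => h h'.2), sub_zero]

theorem gradingSo7_mem : gradingSo7 ∈ conformalParabolic := by
  intro a ha
  change entry (F 0 0) a 0 = 0
  rw [entry_F, if_neg (fun h => ha h.1.symm), if_neg (fun h => by simpa [Fin.rev] using h.2),
    sub_zero]

theorem sqrtTwo_mul_self : sqrtTwo * sqrtTwo = 2 := by
  rw [sqrtTwo, ← Complex.ofReal_mul, Real.mul_self_sqrt (by norm_num)]
  norm_num

theorem sqrtTwo_ne_zero : sqrtTwo ≠ 0 := fun h => by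
  have := sqrtTwo_mul_self
  simp [h] at this

theorem F_three_three : F 3 3 = 0 := by
  refine so7_ext fun a b => ?_
  rw [entry_F]
  exact sub_self _

theorem lie_g2_gm2 : ⁅g2, gm2⁆ = F 1 1 - F 2 2 := by
  rw [g2, gm2, lie_F]
  simp [Fin.rev]

theorem gradingG2_eq : gradingG2 = (2 : ℂ) • F 0 0 + F 1 1 + F 2 2 := by
  have h11 : ⁅g1, gm1⁆ = F 0 0 - F 1 1 := by rw [g1, gm1, lie_F]; simp [Fin.rev]
  have h13 : ⁅g1, gm3⁆ = 0 := by rw [g1, gm3, lie_smul, lie_F]; simp [Fin.rev]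
  have h31 : ⁅g3, gm1⁆ = 0 := by rw [g3, gm1, smul_lie, lie_F]; simp [Fin.rev]
  have h33 : ⁅g3, gm3⁆ = (2 : ℂ) • F 2 2 := by
    rw [g3, gm3, smul_lie, lie_smul, smul_smul, sqrtTwo_mul_self, lie_F]
    simp [Fin.rev, F_three_three]
  rw [gradingG2, lie_g2_gm2, lie_add, add_lie, add_lie, h11, h13, h31, h33]
  module

theorem g1_add_g3_mem : g1 + g3 ∈ conformalParabolic :=
  add_mem (F_mem (by decide) (by decide))
    (conformalParabolic.smul_mem _ (F_mem (by decide) (by decide)))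

theorem gradingG2_mem : gradingG2 ∈ conformalParabolic := by
  rw [gradingG2_eq]
  exact add_mem (add_mem (conformalParabolic.smul_mem _ gradingSo7_mem)
    (F_mem (by decide) (by decide))) (F_mem (by decide) (by decide))

theorem g1_add_g3_mem_nilradical : g1 + g3 ∈ nilradical gradingG2 parabolicG2 := by
  refine Submodule.subset_span ⟨⟨LieSubalgebra.subset_lieSpan (by simp), g1_add_g3_mem⟩, 1,
    one_pos, ?_⟩
  rw [gradingG2_eq, g1, g3]
  simp only [lie_add, add_lie, smul_lie, lie_smul, lie_F]
  simp [Fin.rev]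
  module

theorem lie_gradingG2_g2 : ⁅gradingG2, g2⁆ = 0 := by
  rw [gradingG2_eq, g2]
  simp only [add_lie, smul_lie, lie_F]
  simp [Fin.rev]

theorem lie_gradingG2_gm2 : ⁅gradingG2, gm2⁆ = 0 := by
  rw [gradingG2_eq, gm2]
  simp only [add_lie, smul_lie, lie_F]
  simp [Fin.rev]

theorem g2_mem_levi : g2 ∈ levi gradingG2 parabolicG2 :=
  ⟨⟨LieSubalgebra.subset_lieSpan (by simp), F_mem (by decide) (by decide)⟩, lie_gradingG2_g2⟩

theorem gm2_mem_levi : gm2 ∈ levi gradingG2 parabolicG2 :=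
  ⟨⟨LieSubalgebra.subset_lieSpan (by simp), F_mem (by decide) (by decide)⟩, lie_gradingG2_gm2⟩

theorem lie_lie_g2 : ⁅⁅g2, gm2⁆, g2⁆ = (2 : ℂ) • g2 := by
  rw [lie_g2_gm2, g2]
  simp only [sub_lie, lie_F]
  simp [Fin.rev]
  module

theorem lie_lie_gm2 : ⁅⁅g2, gm2⁆, gm2⁆ = (-2 : ℂ) • gm2 := by
  rw [lie_g2_gm2, gm2]
  simp only [sub_lie, lie_F]
  simp [Fin.rev]
  module

theorem smul_eq_zero_of_toU_smul {lam c : ℂ} (hc : c ≠ 0) {A : So7} {v : Verma lam}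
    (h : toU (c • A) • v = 0) : toU A • v = 0 := by
  rw [map_smul, smul_assoc] at h
  exact (smul_eq_zero.1 h).resolve_left hc

theorem toU_smul_eq_zero_of_singularG2 {lam : ℂ} {v : Verma lam} (hv : v ∈ singularG2 lam) :
    toU g2 • v = 0 ∧ toU gm2 • v = 0 ∧ toU (g1 + g3) • v = 0 := by
  obtain ⟨h1, h2⟩ := hv
  -- Bracketing with the coroot rescales `g2` and `gm2`, so both lie in `[𝔩, 𝔩]`.
  have hl : ⁅g2, gm2⁆ ∈ levi gradingG2 parabolicG2 := LieSubalgebra.lie_mem _ g2_mem_levi gm2_mem_levi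
  refine ⟨smul_eq_zero_of_toU_smul two_ne_zero (lie_lie_g2 ▸ h2 _ hl _ g2_mem_levi),
    smul_eq_zero_of_toU_smul (neg_ne_zero.2 two_ne_zero) (lie_lie_gm2 ▸ h2 _ hl _ gm2_mem_levi),
    h1 _ g1_add_g3_mem_nilradical⟩

theorem F_mem_levi {i j : Fin 7} (hj : j ≠ 0) (hi : i ≠ 6) (hi' : i ≠ 0) (hj' : j ≠ 6) :
    F i j ∈ levi gradingSo7 conformalParabolic := by
  refine ⟨F_mem hj hi, ?_⟩
  have h1 : ¬ i.rev = 0 := fun h => hi (by rw [← Fin.rev_rev i, h]; rfl)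
  have h2 : ¬ (0 : Fin 7) = j.rev := fun h => hj' (by rw [← Fin.rev_rev j, ← h]; rfl)
  rw [gradingSo7, lie_F, if_neg hi'.symm, if_neg hj, if_neg h2, if_neg h1]
  simp

/-- Here `g1` lies in the nilradical and `g2`, `gm2`, `g3` in `[𝔩, 𝔩]`. The weaker conclusion on the
sum is kept so that one classification serves both notions. -/
theorem toU_smul_eq_zero_of_singularSo7 {lam : ℂ} {v : Verma lam} (hv : v ∈ singularSo7 lam) :
    toU g2 • v = 0 ∧ toU gm2 • v = 0 ∧ toU (g1 + g3) • v = 0 := by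
  obtain ⟨h1, h2⟩ := hv
  have e1 : ⁅F 1 1, F 1 2⁆ = F 1 2 := by rw [lie_F]; simp [Fin.rev]
  have e2 : ⁅F 2 2, F 2 1⁆ = F 2 1 := by rw [lie_F]; simp [Fin.rev]
  have e3 : ⁅F 2 2, F 2 3⁆ = F 2 3 := by rw [lie_F]; simp [Fin.rev]
  have hm : ∀ i j : Fin 7, j ≠ 0 → i ≠ 6 → i ≠ 0 → j ≠ 6 →
    F i j ∈ levi gradingSo7 conformalParabolic := fun i j a b c d => F_mem_levi a b c d
  have k1 := h2 _ (hm 1 1 (by decide) (by decide) (by decide) (by decide)) _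
    (hm 1 2 (by decide) (by decide) (by decide) (by decide))
  have k2 := h2 _ (hm 2 2 (by decide) (by decide) (by decide) (by decide)) _
    (hm 2 1 (by decide) (by decide) (by decide) (by decide))
  have k3 := h2 _ (hm 2 2 (by decide) (by decide) (by decide) (by decide)) _
    (hm 2 3 (by decide) (by decide) (by decide) (by decide))
  have k4 : toU g1 • v = 0 := h1 _ (Submodule.subset_span
    ⟨F_mem (by decide) (by decide), 1, one_pos, by
      rw [gradingSo7, g1, lie_F]; simp [Fin.rev]⟩)
  rw [e1] at k1
  rw [e2] at k2
  rw [e3] at k3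
  refine ⟨k1, k2, ?_⟩
  rw [map_add, add_smul, k4, g3, map_smul, smul_assoc, k3, smul_zero, zero_add]

/-! ### The generators as differential operators. -/

theorem act_eq {lam : ℂ} {A : So7} (h : ∀ i, entry A (idx i) 0 = 0) (h0 : entry A 0 0 = 0)
    (f : Poly5) :
    act lam A f = leviDer A f + ∑ i, C (entry A 0 (idx i)) * conformalOp lam i f := by
  change actFun lam A f = _
  rw [actFun, vacuum]
  simp [h, h0]

theorem act_g2 (lam : ℂ) (f : Poly5) : act lam g2 f = longRaise f := by
  have h : leviDer g2 = longRaise := by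
    refine derivation_ext fun i => ?_
    rw [leviDer_X]
    fin_cases i <;> simp [longRaise, mkDerivation_X, Fin.sum_univ_five, g2, entry_F, idx, Fin.rev]
  rw [act_eq, h, Finset.sum_eq_zero, add_zero]
  · intro i _
    fin_cases i <;> simp [g2, entry_F, idx, Fin.rev]
  · intro i
    fin_cases i <;> simp [g2, entry_F, idx, Fin.rev]
  · simp [g2, entry_F, Fin.rev]

theorem act_gm2 (lam : ℂ) (f : Poly5) : act lam gm2 f = longLower f := by
  have h : leviDer gm2 = longLower := by
    refine derivation_ext fun i => ?_
    rw [leviDer_X]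
    fin_cases i <;> simp [longLower, mkDerivation_X, Fin.sum_univ_five, gm2, entry_F, idx, Fin.rev]
  rw [act_eq, h, Finset.sum_eq_zero, add_zero]
  · intro i _
    fin_cases i <;> simp [gm2, entry_F, idx, Fin.rev]
  · intro i
    fin_cases i <;> simp [gm2, entry_F, idx, Fin.rev]
  · simp [gm2, entry_F, Fin.rev]

theorem act_g1 (lam : ℂ) (f : Poly5) : act lam g1 f = conformalOp lam 0 f := by
  have h : leviDer g1 = 0 := by
    refine derivation_ext fun i => ?_
    rw [leviDer_X]
    fin_cases i <;> simp [Fin.sum_univ_five, g1, entry_F, idx, Fin.rev]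
  rw [act_eq, h]
  · simp [Fin.sum_univ_five, g1, entry_F, idx, Fin.rev]
  · intro i
    fin_cases i <;> simp [g1, entry_F, idx, Fin.rev]
  · simp [g1, entry_F, Fin.rev]

theorem act_F_two_three (lam : ℂ) (f : Poly5) : act lam (F 2 3) f = shortRaise f := by
  have h : leviDer (F 2 3) = shortRaise := by
    refine derivation_ext fun i => ?_
    rw [leviDer_X]
    fin_cases i <;> simp [shortRaise, mkDerivation_X, Fin.sum_univ_five, entry_F, idx, Fin.rev]
  rw [act_eq, h, Finset.sum_eq_zero, add_zero]
  · intro i _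
    fin_cases i <;> simp [entry_F, idx, Fin.rev]
  · intro i
    fin_cases i <;> simp [entry_F, idx, Fin.rev]
  · simp [entry_F, Fin.rev]

theorem exists_toPoly_eq_aeval_quadric {lam : ℂ} {v : Verma lam}
    (h : toU g2 • v = 0 ∧ toU gm2 • v = 0 ∧ toU (g1 + g3) • v = 0) :
    ∃ q : Polynomial ℂ, toPoly lam v = Polynomial.aeval quadric q ∧
      Polynomial.C (lam + 3 / 2) * Polynomial.derivative q
          = Polynomial.X * Polynomial.derivative (Polynomial.derivative q) := by
  have hz : ∀ A, toU A • v = 0 → act lam A (toPoly lam v) = 0 := by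
    intro A hA
    rw [← repU_toU, ← toPoly_smul, hA, map_zero]
  obtain ⟨h1, h2, h3⟩ := h
  refine exists_eq_aeval_quadric sqrtTwo_ne_zero (by rw [← act_g2 lam, hz _ h1])
    (by rw [← act_gm2 lam, hz _ h2]) ?_
  rw [← act_g1, ← act_F_two_three lam, ← LinearMap.smul_apply, ← act_smul, ← LinearMap.add_apply,
    ← act_add]
  exact hz _ h3

/-! ### Singularity of powers of the quadric. -/

theorem entry_lie_zero_zero {A B : So7} (hA : A ∈ conformalParabolic)
    (hB : B ∈ conformalParabolic) : entry ⁅A, B⁆ 0 0 = 0 := by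
  have h : ∀ A B : So7, A ∈ conformalParabolic → B ∈ conformalParabolic →
      ∑ k, entry A 0 k * entry B k 0 = entry A 0 0 * entry B 0 0 := by
    intro A B _ hB
    refine Finset.sum_eq_single 0 (fun k _ hk => ?_) (fun h => absurd (Finset.mem_univ _) h)
    rw [show entry B k 0 = 0 from hB k hk, mul_zero]
  rw [entry_lie, h A B hA hB, h B A hB hA]
  ring

/-- A vector annihilated by the kernel of the characters of `𝔭` is singular for every parabolic
subalgebra contained in `𝔭` whose grading element is in `𝔭`. -/
theorem mem_singularVectors {lam : ℂ} {v : Verma lam}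
    (hv : ∀ A ∈ conformalParabolic, entry A 0 0 = 0 → toU A • v = 0) {H : So7}
    (hH : H ∈ conformalParabolic) {𝔮 : LieSubalgebra ℂ So7} (h𝔮 : 𝔮 ≤ conformalParabolic) :
    v ∈ singularVectors lam H 𝔮 := by
  refine ⟨fun A hA => ?_, fun A hA B hB => ?_⟩
  · rw [nilradical] at hA
    induction hA using Submodule.span_induction with
    | mem A h =>
      obtain ⟨hA, k, hk, h⟩ := h
      refine hv A (h𝔮 hA) ?_
      have h0 := entry_lie_zero_zero hH (h𝔮 hA)
      rw [h, entry_smul] at h0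
      exact (mul_eq_zero.1 h0).resolve_left (by exact_mod_cast hk.ne')
    | zero => rw [map_zero, zero_smul]
    | add A B _ _ hA hB => rw [map_add, add_smul, hA, hB, add_zero]
    | smul c A _ hA => rw [map_smul, smul_assoc, hA, smul_zero]
  · exact hv _ (conformalParabolic.lie_mem (h𝔮 hA.1) (h𝔮 hB.1))
      (entry_lie_zero_zero (h𝔮 hA.1) (h𝔮 hB.1))

/-- With `entry A 0 0 = 0` the Levi component is orthogonal for the form of `Q`: antisymmetric
coefficients are paired with symmetric monomials, so the sum equals its own negative. -/
theorem leviDer_quadric {A : So7} (h0 : entry A 0 0 = 0) : leviDer A quadric = 0 := by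
  have hS : ∑ k : Fin 5, X k.rev * leviDer A (X k) = 0 := by
    have h1 : ∑ k : Fin 5, X k.rev * leviDer A (X k) =
        ∑ k : Fin 5, ∑ j : Fin 5, C (entry A (idx j) (idx k)) * (X j * X k.rev) := by
      refine Finset.sum_congr rfl fun k _ => ?_
      rw [leviDer_X, h0, C_0, zero_mul, sub_zero, Finset.mul_sum]
      exact Finset.sum_congr rfl fun j _ => by ring
    have h2 : ∑ k : Fin 5, ∑ j : Fin 5, C (entry A (idx j) (idx k)) * (X j * X k.rev : Poly5) =
        -∑ k : Fin 5, ∑ j : Fin 5, C (entry A (idx j) (idx k)) * (X j * X k.rev) := by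
      conv_lhs => rw [Finset.sum_comm]
      rw [← Finset.sum_neg_distrib]
      refine Fintype.sum_equiv Fin.revPerm _ _ fun j => ?_
      rw [← Finset.sum_neg_distrib]
      refine Fintype.sum_equiv Fin.revPerm _ _ fun k => ?_
      simp only [Fin.revPerm_apply, Fin.rev_rev, idx_rev, entry_rev, C_neg]
      ring
    have h3 : (2 : ℂ) • ∑ k : Fin 5, X k.rev * leviDer A (X k) = 0 := by
      rw [h1, two_smul]
      linear_combination h2
    exact (smul_eq_zero.1 h3).resolve_left two_ne_zero
  have h := congrArg (leviDer A) sum_X_mul_X_rev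
  rw [map_sum] at h
  have hr : ∑ k : Fin 5, X k * leviDer A (X k.rev) = ∑ k : Fin 5, X k.rev * leviDer A (X k) :=
    Fintype.sum_equiv Fin.revPerm _ _ fun k => by simp
  simp only [Derivation.leibniz, smul_eq_mul, Finset.sum_add_distrib, hr, hS] at h
  rw [show (2 : Poly5) = C 2 from rfl, derivation_C, mul_zero, add_zero, add_zero] at h
  exact (mul_eq_zero.1 h.symm).resolve_left (C_ne_zero.2 two_ne_zero)

theorem toU_smul_eq_zero_of_toPoly {lam : ℂ} {v : Verma lam} {N : ℕ} (hlam : lam = N - 5 / 2)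
    {a b : ℂ} (hv : toPoly lam v = C a + C b * quadric ^ N) {A : So7}
    (hA : A ∈ conformalParabolic) (h0 : entry A 0 0 = 0) : toU A • v = 0 := by
  apply toPoly_injective lam
  rw [toPoly_smul, repU_toU, map_zero, hv, act_eq (fun i => hA _ (idx_ne_zero i)) h0]
  have h1 : leviDer A (C a + C b * quadric ^ N) = 0 := by
    rw [map_add, derivation_C, derivation_C_mul_eq, Derivation.leibniz_pow, leviDer_quadric h0]
    simp
  have h2 : ∀ i, conformalOp lam i (C a + C b * quadric ^ N) = 0 := by
    intro i
    rw [map_add, ← mul_one (C a), C_mul', C_mul', map_smul, map_smul, conformalOp_one,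
      conformalOp_quadric_pow hlam, smul_zero, smul_zero, add_zero]
  rw [h1, zero_add]
  exact Finset.sum_eq_zero fun i _ => by rw [h2, mul_zero]

theorem hwv_annihilated (lam : ℂ) {A : So7} (hA : A ∈ conformalParabolic)
    (h0 : entry A 0 0 = 0) : toU A • hwv lam = 0 := by
  rw [parabolic_smul_hwv lam hA, h0, mul_zero, map_zero, zero_smul]

/-! ### The invariants `u₁`, `u₂` in the model and the classification. -/

theorem u1_eq : u1 = polyToU (X 0 * X 4 + X 3 * X 1) := by
  rw [map_add, map_mul, map_mul, polyToU_X, polyToU_X, polyToU_X, polyToU_X]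
  rfl

theorem u2_eq : u2 = polyToU (C 2 * X 2 ^ 2) := by
  have h : toU gm6 = sqrtTwo • toU (lowering 2) := map_smul toU sqrtTwo (F 3 0)
  rw [u2, h, smul_pow, pow_two sqrtTwo, sqrtTwo_mul_self, C_mul', map_smul, map_pow, polyToU_X]

theorem special_eq (N : ℕ) :
    ((4 : ℂ) • u1 + u2) ^ N = polyToU (C (4 ^ N) * quadric ^ N) := by
  have h : (4 : ℂ) • u1 + u2 = polyToU (C 4 * quadric) := by
    rw [u1_eq, u2_eq, ← map_smul, ← map_add, ← C_mul']
    congr 1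
    have h4 : (C 2 : Poly5) = C 4 * C 2⁻¹ := by rw [← C_mul]; norm_num
    rw [h4, quadric]
    ring
  rw [h, ← map_pow, mul_pow, C_pow]

theorem toPoly_specialVector (lam : ℂ) (N : ℕ) :
    toPoly lam (specialVector lam N) = C (4 ^ N) * quadric ^ N := by
  rw [specialVector, special_eq, toPoly_polyToU]

theorem quadric_pow_ne_zero (N : ℕ) : quadric ^ N ≠ 0 := by
  refine pow_ne_zero N fun h => ?_
  have := congrArg (eval ![1, 0, 0, 0, 1]) h
  simp [quadric] at this

theorem isHomogeneous_C_mul_quadric_pow (b : ℂ) (N : ℕ) :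
    (C b * quadric ^ N).IsHomogeneous (2 * N) :=
  (isHomogeneous_quadric.pow N).C_mul b

theorem C_eq_zero_of_isHomogeneous {a : ℂ} {d : ℕ} (hd : d ≠ 0)
    (h : (C a : Poly5).IsHomogeneous d) : a = 0 := by
  by_contra ha
  exact hd (h.inj_right (isHomogeneous_C _ a) (C_ne_zero.2 ha))

/-- The homogeneous vectors annihilated by the generators of `i(𝔭')` are multiples of powers of the
quadric. -/
theorem exists_toPoly_eq_quadric_pow {lam : ℂ} {v : Verma lam}
    (h : toU g2 • v = 0 ∧ toU gm2 • v = 0 ∧ toU (g1 + g3) • v = 0) {d : ℕ} (hd : d ≠ 0)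
    (hv : v ∈ homogeneousPart lam d) (hv0 : v ≠ 0) :
    ∃ N : ℕ, 0 < N ∧ d = 2 * N ∧ lam = N - 5 / 2 ∧
      ∃ b : ℂ, b ≠ 0 ∧ toPoly lam v = C b * quadric ^ N := by
  rw [mem_homogeneousPart_iff] at hv
  have hne : toPoly lam v ≠ 0 := fun h => hv0 (toPoly_injective lam (by rw [h, map_zero]))
  obtain ⟨q, hq, hr⟩ := exists_toPoly_eq_aeval_quadric h
  by_cases hlam : ∀ n : ℕ, 0 < n → lam ≠ n - 5 / 2
  · obtain ⟨a, rfl⟩ := eq_C_of_radial hr hlam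
    rw [Polynomial.aeval_C, algebraMap_eq] at hq
    rw [hq] at hv hne
    exact absurd (by rw [C_eq_zero_of_isHomogeneous hd hv, C_0]) hne
  · push Not at hlam
    obtain ⟨N, hN, hlam⟩ := hlam
    obtain ⟨a, b, rfl⟩ := eq_C_add_of_radial hr hN hlam
    rw [map_add, map_mul, map_pow, Polynomial.aeval_X, Polynomial.aeval_C, Polynomial.aeval_C,
      algebraMap_eq] at hq
    -- Homogeneity in positive degree excludes the constant solution.
    have ha : a = 0 := by
      have h0 := congrArg constantCoeff hq
      rw [show constantCoeff (toPoly lam v) = 0 from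
        hv.coeff_eq_zero (by simpa using hd.symm)] at h0
      simpa [quadric, hN.ne'] using h0.symm
    rw [ha, C_0, zero_add] at hq
    have hb : b ≠ 0 := by
      rintro rfl
      rw [hq, C_0, zero_mul] at hne
      exact hne rfl
    refine ⟨N, hN, ?_, hlam, b, hb, hq⟩
    rw [hq] at hv hne
    exact hv.inj_right (isHomogeneous_C_mul_quadric_pow b N) hne

theorem four_pow_ne_zero (N : ℕ) : (4 : ℂ) ^ N ≠ 0 := pow_ne_zero N (by norm_num)

theorem eq_smul_hwv {lam : ℂ} {v : Verma lam} {a : ℂ} (h : toPoly lam v = C a) :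
    v = a • hwv lam :=
  toPoly_injective lam (by rw [h, map_smul, toPoly_hwv, smul_eq_C_mul, mul_one])

theorem eq_smul_specialVector {lam : ℂ} {v : Verma lam} {a b : ℂ} {N : ℕ}
    (h : toPoly lam v = C a + C b * quadric ^ N) :
    v = a • hwv lam + (b / 4 ^ N) • specialVector lam N := by
  refine toPoly_injective lam ?_
  rw [h, map_add, map_smul, map_smul, toPoly_hwv, toPoly_specialVector, smul_eq_C_mul,
    smul_eq_C_mul, mul_one, ← mul_assoc, ← C_mul, div_mul_cancel₀ _ (four_pow_ne_zero N)]

theorem hwv_mem_singularSo7 (lam : ℂ) : hwv lam ∈ singularSo7 lam :=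
  mem_singularVectors (fun _ => hwv_annihilated lam) gradingSo7_mem le_rfl

theorem hwv_mem_singularG2 (lam : ℂ) : hwv lam ∈ singularG2 lam :=
  mem_singularVectors (fun _ => hwv_annihilated lam) gradingG2_mem inf_le_right

theorem specialVector_annihilated {lam : ℂ} {N : ℕ} (hlam : lam = N - 5 / 2) {A : So7}
    (hA : A ∈ conformalParabolic) (h0 : entry A 0 0 = 0) : toU A • specialVector lam N = 0 :=
  toU_smul_eq_zero_of_toPoly hlam (a := 0) (b := 4 ^ N)
    (by rw [toPoly_specialVector, C_0, zero_add]) hA h0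

theorem specialVector_mem_singularSo7 {lam : ℂ} {N : ℕ} (hlam : lam = N - 5 / 2) :
    specialVector lam N ∈ singularSo7 lam :=
  mem_singularVectors (fun _ => specialVector_annihilated hlam) gradingSo7_mem le_rfl

theorem specialVector_mem_singularG2 {lam : ℂ} {N : ℕ} (hlam : lam = N - 5 / 2) :
    specialVector lam N ∈ singularG2 lam :=
  mem_singularVectors (fun _ => specialVector_annihilated hlam) gradingG2_mem inf_le_right

theorem specialVector_mem_homogeneousPart (lam : ℂ) (N : ℕ) :
    specialVector lam N ∈ homogeneousPart lam (2 * N) := by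
  rw [mem_homogeneousPart_iff, toPoly_specialVector]
  exact isHomogeneous_C_mul_quadric_pow _ N

theorem mem_span_of_annihilated {lam : ℂ} {N : ℕ} (hN : 0 < N) (hlam : lam = N - 5 / 2)
    {v : Verma lam} (h : toU g2 • v = 0 ∧ toU gm2 • v = 0 ∧ toU (g1 + g3) • v = 0) :
    v ∈ Submodule.span ℂ {hwv lam, specialVector lam N} := by
  obtain ⟨q, hq, hr⟩ := exists_toPoly_eq_aeval_quadric h
  obtain ⟨a, b, rfl⟩ := eq_C_add_of_radial hr hN hlam
  rw [map_add, map_mul, map_pow, Polynomial.aeval_X, Polynomial.aeval_C, Polynomial.aeval_C,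
    algebraMap_eq] at hq
  exact Submodule.mem_span_pair.2 ⟨a, b / 4 ^ N, (eq_smul_specialVector hq).symm⟩

theorem mem_span_hwv_of_annihilated {lam : ℂ} (hlam : ∀ N : ℕ, 0 < N → lam ≠ N - 5 / 2)
    {v : Verma lam} (h : toU g2 • v = 0 ∧ toU gm2 • v = 0 ∧ toU (g1 + g3) • v = 0) :
    v ∈ Submodule.span ℂ {hwv lam} := by
  obtain ⟨q, hq, hr⟩ := exists_toPoly_eq_aeval_quadric h
  obtain ⟨a, rfl⟩ := eq_C_of_radial hr hlam
  rw [Polynomial.aeval_C, algebraMap_eq] at hq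
  exact Submodule.mem_span_singleton.2 ⟨a, (eq_smul_hwv hq).symm⟩

/-- The polynomial that corresponds to `∑ A_k u₁^k u₂^(N-k)`. -/
def invariantPoly (N : ℕ) (A : ℕ → ℂ) : Poly5 :=
  ∑ k ∈ Finset.range (N + 1),
    A k • ((X 0 * X 4 + X 3 * X 1) ^ k * (C 2 * X 2 ^ 2) ^ (N - k))

theorem polyToU_invariantPoly (N : ℕ) (A : ℕ → ℂ) : polyToU (invariantPoly N A) =
    ∑ k ∈ Finset.range (N + 1), A k • (u1 ^ k * u2 ^ (N - k)) := by
  rw [invariantPoly, map_sum]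
  refine Finset.sum_congr rfl fun k _ => ?_
  rw [map_smul, map_mul, map_pow, map_pow, u1_eq, u2_eq]

/-- Substituting `X₀ = 1`, `X₁ = X₃ = 0`, `X₂ = √2/2`, `X₄ = t` sends `u₁` to `t` and `u₂` to `1`,
so the coefficients `A k` reappear as those of a polynomial in `t`. -/
theorem invariantPoly_ne_zero {N : ℕ} {A : ℕ → ℂ} (hA : ∃ k ≤ N, A k ≠ 0) :
    invariantPoly N A ≠ 0 := by
  obtain ⟨k, hk, hA⟩ := hA
  intro h
  apply hA
  have hc : (2 : Polynomial ℂ) * Polynomial.C (sqrtTwo / 2) ^ 2 = 1 := by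
    rw [show (2 : Polynomial ℂ) = Polynomial.C 2 from rfl, ← Polynomial.C_pow, ← Polynomial.C_mul,
      div_pow, pow_two sqrtTwo, sqrtTwo_mul_self]
    norm_num
  have h' := congrArg (aeval ![1, 0, Polynomial.C (sqrtTwo / 2), 0, (Polynomial.X : Polynomial ℂ)]) h
  have h2 : (aeval ![1, 0, Polynomial.C (sqrtTwo / 2), 0, (Polynomial.X : Polynomial ℂ)])
      (C 2 * X 2 ^ 2 : Poly5) = 1 := by
    rw [map_mul, map_pow, aeval_X, aeval_C]
    exact hc
  have h1 : (aeval ![1, 0, Polynomial.C (sqrtTwo / 2), 0, (Polynomial.X : Polynomial ℂ)])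
      (X 0 * X 4 + X 3 * X 1 : Poly5) = Polynomial.X := by
    simp
  rw [invariantPoly, map_sum, map_zero] at h'
  have ht : ∀ k, (aeval ![1, 0, Polynomial.C (sqrtTwo / 2), 0, (Polynomial.X : Polynomial ℂ)])
      (A k • ((X 0 * X 4 + X 3 * X 1) ^ k * (C 2 * X 2 ^ 2) ^ (N - k) : Poly5))
      = A k • Polynomial.X ^ k := by
    intro k
    rw [map_smul, map_mul, map_pow, map_pow, h1, h2, one_pow, mul_one]
  rw [Finset.sum_congr rfl fun k _ => ht k] at h'
  have h'' := congrArg (fun p => Polynomial.coeff p k) h'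
  simpa [Polynomial.finsetSum_coeff, Polynomial.coeff_X_pow, Nat.lt_succ_iff, hk] using h''

end G2Verma

end

open G2Verma in
theorem theorem1 (lam : ℂ) :
    -- (0) the highest weight vector is nonzero and singular for both parabolic subalgebras
    (hwv lam ≠ 0 ∧ hwv lam ∈ singularSo7 lam ∧ hwv lam ∈ singularG2 lam) ∧
    -- (1) singular vectors of the form `∑ A_k u₁^k u₂^(N-k) · v_λ`, of homogeneity `2N`
    (∀ N : ℕ, 0 < N → ∀ A : ℕ → ℂ, (∃ k ≤ N, A k ≠ 0) →
      (((∑ k ∈ Finset.range (N + 1), A k • (u1 ^ k * u2 ^ (N - k))) • hwv lam ∈ singularG2 lam ∧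
        (∑ k ∈ Finset.range (N + 1), A k • (u1 ^ k * u2 ^ (N - k))) • hwv lam
          ∈ homogeneousPart lam (2 * N)) ↔
        (lam = (N : ℂ) - 5 / 2 ∧
          ∃ c : ℂ, c ≠ 0 ∧
            ∑ k ∈ Finset.range (N + 1), A k • (u1 ^ k * u2 ^ (N - k)) =
              c • ((4 : ℂ) • u1 + u2) ^ N))) ∧
    -- (2) no singular vectors of odd homogeneity
    (∀ N : ℕ, ∀ v ∈ homogeneousPart lam (2 * N + 1), v ∈ singularG2 lam → v = 0) ∧
    -- (3) homogeneous `so(7) ∩ 𝔭`-singular vectors not proportional to `v_λ`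
    (∀ v : Verma lam, v ∉ Submodule.span ℂ {hwv lam} →
      ((v ∈ singularSo7 lam ∧ ∃ d : ℕ, v ∈ homogeneousPart lam d) ↔
        ∃ N : ℕ, 0 < N ∧ lam = (N : ℂ) - 5 / 2 ∧
          ∃ c : ℂ, c ≠ 0 ∧ v = c • specialVector lam N)) ∧
    -- (4) all singular vectors, homogeneous or not, for `λ ∈ {-3/2, -1/2, 1/2, …}`
    (∀ N : ℕ, 0 < N → lam = (N : ℂ) - 5 / 2 →
      LinearIndependent ℂ ![hwv lam, specialVector lam N] ∧
      singularG2 lam = Submodule.span ℂ {hwv lam, specialVector lam N} ∧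
      singularSo7 lam = Submodule.span ℂ {hwv lam, specialVector lam N}) ∧
    -- (5) all singular vectors for the other values of `λ`
    ((∀ N : ℕ, 0 < N → lam ≠ (N : ℂ) - 5 / 2) →
      singularG2 lam = Submodule.span ℂ {hwv lam} ∧
      singularSo7 lam = Submodule.span ℂ {hwv lam}) := by
  have hg : ∀ v ∈ singularG2 lam, toU g2 • v = 0 ∧ toU gm2 • v = 0 ∧ toU (g1 + g3) • v = 0 :=
    fun v hv => toU_smul_eq_zero_of_singularG2 hv
  have hs : ∀ v ∈ singularSo7 lam, toU g2 • v = 0 ∧ toU gm2 • v = 0 ∧ toU (g1 + g3) • v = 0 :=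
    fun v hv => toU_smul_eq_zero_of_singularSo7 hv
  refine ⟨⟨hwv_ne_zero lam, hwv_mem_singularSo7 lam, hwv_mem_singularG2 lam⟩, ?_, ?_, ?_, ?_, ?_⟩
  · intro N hN A hA
    rw [← polyToU_invariantPoly]
    constructor
    · rintro ⟨h1, h2⟩
      have hne : polyToU (invariantPoly N A) • hwv lam ≠ 0 := fun h =>
        invariantPoly_ne_zero hA (by rw [← toPoly_polyToU lam (invariantPoly N A), h, map_zero])
      obtain ⟨M, -, hM, hlam, b, hb, hv⟩ :=
        exists_toPoly_eq_quadric_pow (hg _ h1) (by omega) h2 hne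
      obtain rfl : N = M := by omega
      refine ⟨hlam, b / 4 ^ N, div_ne_zero hb (four_pow_ne_zero N), ?_⟩
      -- The equality holds between polynomials, so applying `polyToU` yields it in `U`, not merely
      -- on the highest weight vector.
      rw [toPoly_polyToU] at hv
      rw [hv, special_eq, ← map_smul, ← MvPolynomial.C_mul', ← mul_assoc, ← MvPolynomial.C_mul,
        div_mul_cancel₀ _ (four_pow_ne_zero N)]
    · rintro ⟨hlam, c, -, hc⟩
      have hv : polyToU (invariantPoly N A) • hwv lam = c • specialVector lam N := by
        rw [hc, smul_assoc, specialVector]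
      rw [hv]
      exact ⟨Submodule.smul_mem _ _ (specialVector_mem_singularG2 hlam),
        Submodule.smul_mem _ _ (specialVector_mem_homogeneousPart lam N)⟩
  · intro N v hv hvs
    by_contra hne
    obtain ⟨M, -, hM, -⟩ := exists_toPoly_eq_quadric_pow (hg v hvs) (by omega) hv hne
    omega
  · intro v hv
    constructor
    · rintro ⟨hvs, d, hd⟩
      have hne : v ≠ 0 := by
        rintro rfl
        exact hv (Submodule.zero_mem _)
      -- Homogeneity zero means a constant polynomial, that is, a multiple of `v_λ`.
      have hd0 : d ≠ 0 := by
        rintro rfl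
        rw [mem_homogeneousPart_iff, ← MvPolynomial.totalDegree_zero_iff_isHomogeneous,
          MvPolynomial.totalDegree_eq_zero_iff_eq_C] at hd
        exact hv (Submodule.mem_span_singleton.2 ⟨_, (eq_smul_hwv hd).symm⟩)
      obtain ⟨N, hN, -, hlam, b, hb, h⟩ := exists_toPoly_eq_quadric_pow (hs v hvs) hd0 hd hne
      refine ⟨N, hN, hlam, b / 4 ^ N, div_ne_zero hb (four_pow_ne_zero N), ?_⟩
      have := eq_smul_specialVector (a := 0) (b := b) (N := N)
        (by rw [h, MvPolynomial.C_0, zero_add])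
      rwa [zero_smul, zero_add] at this
    · rintro ⟨N, -, hlam, c, -, rfl⟩
      exact ⟨Submodule.smul_mem _ _ (specialVector_mem_singularSo7 hlam), 2 * N,
        Submodule.smul_mem _ _ (specialVector_mem_homogeneousPart lam N)⟩
  · intro N hN hlam
    refine ⟨?_, ?_, ?_⟩
    · rw [LinearIndependent.pair_iff]
      intro a b hab
      have h := congrArg (toPoly lam) hab
      rw [map_add, map_smul, map_smul, toPoly_hwv, toPoly_specialVector, map_zero,
        MvPolynomial.smul_eq_C_mul, MvPolynomial.smul_eq_C_mul, mul_one] at h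
      -- `Q^N` has no constant term because `N ≥ 1`.
      have ha : a = 0 := by
        have h0 := congrArg MvPolynomial.constantCoeff h
        simpa [quadric, hN.ne'] using h0
      refine ⟨ha, ?_⟩
      rw [ha, MvPolynomial.C_0, zero_add, ← mul_assoc, ← MvPolynomial.C_mul] at h
      have hb := (mul_eq_zero.1 h).resolve_right (quadric_pow_ne_zero N)
      rw [MvPolynomial.C_eq_zero] at hb
      exact (mul_eq_zero.1 hb).resolve_right (four_pow_ne_zero N)
    · refine le_antisymm (fun v hv => mem_span_of_annihilated hN hlam (hg v hv)) ?_
      rw [Submodule.span_le]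
      rintro _ (rfl | rfl)
      exacts [hwv_mem_singularG2 lam, specialVector_mem_singularG2 hlam]
    · refine le_antisymm (fun v hv => mem_span_of_annihilated hN hlam (hs v hv)) ?_
      rw [Submodule.span_le]
      rintro _ (rfl | rfl)
      exacts [hwv_mem_singularSo7 lam, specialVector_mem_singularSo7 hlam]
  · intro hlam
    refine ⟨le_antisymm (fun v hv => mem_span_hwv_of_annihilated hlam (hg v hv)) ?_,
      le_antisymm (fun v hv => mem_span_hwv_of_annihilated hlam (hs v hv)) ?_⟩
    · rw [Submodule.span_le]
      rintro _ rfl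
      exact hwv_mem_singularG2 lam
    · rw [Submodule.span_le]
      rintro _ rfl
      exact hwv_mem_singularSo7 lam
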